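/- Consider $N=N_1+N_2$ spins $\sigma_i\in\{-1,1\}$ split into two populations of equal size $N_1=N_2=N/2$, with Hamiltonian $$H_N(\sigma)=-\frac1{2N}\sum_{i,j=1}^N J_{ij}\sigma_i\sigma_j-\sum_{i=1}^N h_i\sigma_i ,$$ where $J_{ij}=J_{ls}$ and $h_i=h_l$ if $i$ is in population $l$ and $j$ in population $s$, and where $J_{11}=J_{22}>0$ and $J_{12}=J_{21}<0$. For $\beta>0$ let $p_N(\mathbf h)=\frac1N\ln\sum_{\sigma}e^{-\beta H_N(\sigma)}$ be the pressure in the field $\mathbf h=(h_1,h_2)$, let $\lambda_M=J_{11}-J_{12}$ be the larger eigenvalue of $\mathbf J=\begin{pmatrix}J_{11}&J_{12}\\J_{12}&J_{11}\end{pmatrix}$, and put $t=2/(\beta\lambda_M)$. For $\mu\in[-1,1]^2$ let $$f_{\mathbf h}(\mu)=\beta\Big(\tfrac18\big(J_{11}\mu_1^2+2J_{12}\mu_1\mu_2+J_{11}\mu_2^2\big)+\tfrac12(h_1\mu_1+h_2\mu_2)\Big)-\tfrac12\mathscr I(\mu_1)-\tfrac12\mathscr I(\mu_2),$$ $$\mathscr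 I(x)=\tfrac12\big((1+x)\ln(1+x)+(1-x)\ln(1-x)\big)\qquad(0\ln 0=0).$$ The states of the system in the field $\mathbf h$ are the global maximum points of $f_{\mathbf h}$ on $[-1,1]^2$. 1. (Zero field.) If $t\ge1$, then $\lim_{N\to\infty}p_N(\mathbf 0)=\ln2+f_{\mathbf 0}(0,0)=\ln 2$, and $(0,0)$ is the only state. If $t<1$, then the equation $x=\tanh\big(\frac{\beta\lambda_M}{2}x\big)$ has exactly one positive solution $\tilde x$ (its real solutions being $0,\pm\tilde x$), $\lim_{N\to\infty}p_N(\mathbf 0)=\ln2+f_{\mathbf 0}(\tilde x,-\tilde x)>\ln 2$, and the states are exactly $\pm(\tilde x,-\tilde x)$. So the state passes from zero to non-zero magnetization at $t=1$. 2. (Infinitesimal field.) For every $\varepsilon>0$ there is $\delta>0$ such that for every field $\mathbf h$ with $|h_1|,|h_2|<\delta$ and $h_1\ne h_2$ there is exactly one state $m$ in the field $\mathbf h$; it satisfies $\langle m,\mathbf h\rangle>0$ and $\lim_{N\to\infty}p_N(\mathbf h)=\ln2+f_{\mathbf h}(m)$, and it lies within $\varepsilon$ (in the maximum norm) of a zero-field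 state $s$, where, if $t<1$, also $\langle s,\mathbf h\rangle>0$. In contrast, for every $c\in\mathbb R$ the function $f_{(c,c)}$ and its set of maximum points are invariant under $(\mu_1,\mu_2)\mapsto(\mu_2,\mu_1)$; and if $t<1$, then for every $\varepsilon>0$ there is $\delta>0$ such that for $|c|<\delta$ there are exactly two states $m=(m_1,m_2)$ and $(m_2,m_1)$ in the field $(c,c)$, with $m_1\ne m_2$, within $\varepsilon$ of the two zero-field states $s$ and $(s_2,s_1)=-s$ respectively, and $\lim_{N\to\infty}p_N(c,c)=\ln2+f_{(c,c)}(m)=\ln2+f_{(c,c)}(m_2,m_1)$. -/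

import Mathlib

open Filter Topology

noncomputable section

namespace Bipartite

/-- The particles of a two-population system with `n l` particles in population `l`. -/
abbrev Particle (n : Fin 2 → ℕ) : Type := Σ l : Fin 2, Fin (n l)

/-- Spin configurations: every particle carries a spin in `ℤˣ = {1, -1}`. -/
abbrev Config (n : Fin 2 → ℕ) : Type := Particle n → ℤˣ

/-- The total number of particles `N = N₁ + N₂`. -/
def size (n : Fin 2 → ℕ) : ℕ := n 0 + n 1

/-- The spin of particle `i` as a real number. -/
def spin {n : Fin 2 → ℕ} (σ : Config n) (i : Particle n) : ℝ := ((σ i : ℤ) : ℝ)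

/-- The mean-field Hamiltonian `-(1/2N) ∑ J_ij σ_i σ_j - ∑ h_i σ_i`, where the coupling and
the field depend only on the populations of the particles. -/
def hamiltonian (J : Matrix (Fin 2) (Fin 2) ℝ) (h : Fin 2 → ℝ) (n : Fin 2 → ℕ)
    (σ : Config n) : ℝ :=
  -(1 / (2 * (size n : ℝ))) * ∑ i : Particle n, ∑ j : Particle n,
      J i.1 j.1 * spin σ i * spin σ j
    - ∑ i : Particle n, h i.1 * spin σ i

/-- The partition function. -/
def partitionFunction (β : ℝ) (J : Matrix (Fin 2) (Fin 2) ℝ) (h : Fin 2 → ℝ)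
    (n : Fin 2 → ℕ) : ℝ :=
  ∑ σ : Config n, Real.exp (-β * hamiltonian J h n σ)

/-- The pressure `(1/N) ln Z_N`. -/
def pressure (β : ℝ) (J : Matrix (Fin 2) (Fin 2) ℝ) (h : Fin 2 → ℝ) (n : Fin 2 → ℕ) : ℝ :=
  1 / (size n : ℝ) * Real.log (partitionFunction β J h n)

/-- The energy density `g` as a function of the two magnetizations;
`α l` is the relative size of population `l`. -/
def energy (α : Fin 2 → ℝ) (J : Matrix (Fin 2) (Fin 2) ℝ) (h μ : Fin 2 → ℝ) : ℝ :=
  1 / 2 * (α 0 ^ 2 * J 0 0 * μ 0 ^ 2 + 2 * α 0 * α 1 * J 0 1 * μ 0 * μ 1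
      + α 1 ^ 2 * J 1 1 * μ 1 ^ 2)
    + α 0 * h 0 * μ 0 + α 1 * h 1 * μ 1

/-- The entropy function on `[-1, 1]`; since `Real.log 0 = 0`, the terms `0 ln 0` vanish at the
end points, as usual. -/
def entropy (x : ℝ) : ℝ :=
  1 / 2 * ((1 + x) * Real.log (1 + x) + (1 - x) * Real.log (1 - x))

/-- The pressure functional `f`. -/
def functional (β : ℝ) (α : Fin 2 → ℝ) (J : Matrix (Fin 2) (Fin 2) ℝ) (h μ : Fin 2 → ℝ) : ℝ :=
  β * energy α J h μ - α 0 * entropy (μ 0) - α 1 * entropy (μ 1)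

/-- The states of the system: the global maximum points of the pressure functional on the
square `[-1, 1]²` of possible magnetizations. -/
def states (β : ℝ) (α : Fin 2 → ℝ) (J : Matrix (Fin 2) (Fin 2) ℝ) (h : Fin 2 → ℝ) :
    Set (Fin 2 → ℝ) :=
  {μ | μ ∈ Set.Icc (-1) 1 ∧
    ∀ ν ∈ Set.Icc (-1 : Fin 2 → ℝ) 1, functional β α J h ν ≤ functional β α J h μ}

/-- The two populations have equal size: `α₁ = α₂ = 1/2`. -/
def half : Fin 2 → ℝ := fun _ => 1 / 2

/-- Reflection in the diagonal `μ₁ = μ₂`. -/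
def swap (μ : Fin 2 → ℝ) : Fin 2 → ℝ := ![μ 1, μ 0]

/-- The reduced interaction matrix with `J₁₁ = J₂₂`. -/
def coupling (J₁₁ J₁₂ : ℝ) : Matrix (Fin 2) (Fin 2) ℝ := !![J₁₁, J₁₂; J₁₂, J₁₁]

end Bipartite

end

noncomputable section

namespace Bipartite

/-! ### Product measures on configurations -/

/-! Put `K = βλ_M/2 = 1/t` and `G(x) = K x²/2 - I(x)` (`landau`). Completing the square
(`functional_eq`) gives `f_h(μ) = (G(μ₁) + G(μ₂))/2 + βJ₁₂/8 (μ₁ + μ₂)² + β/2 ⟨μ, h⟩`. As `J₁₂ < 0`,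
the middle term is concave, nonpositive and zero exactly on the antidiagonal, so the zero-field
states are the antidiagonal points whose coordinates maximize `G`. For `K ≤ 1`, `G` is strictly
concave with maximum at `0`; for `K > 1` its maximum points are `±x`, and it is strictly concave
beyond its inflection point `r < x` (`exists_landau_max`).

In a small field, compactness keeps states near zero-field states
(`exists_dist_zero_field_state_lt`), and a midpoint argument allows at most one state near each of
them (`eq_of_mem_states`). Comparing a state with its reflection shows that `h₁ - h₂` selects the
corner; if `h₁ = h₂`, the reflection exchanges the two corners.

The pressure limit (`tendsto_pressure`) comes from product measures: the upper bound weighs each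
configuration by the product measure with its own magnetization, of which there are polynomially
many; the lower bound is Jensen's inequality. -/

/-- The magnetization of population `l`. -/
def magnetization {n : Fin 2 → ℕ} (σ : Config n) (l : Fin 2) : ℝ :=
  (∑ i : Fin (n l), spin σ ⟨l, i⟩) / n l

/-- The weight of `σ` under the product measure with mean magnetizations `m`. -/
def weight {n : Fin 2 → ℕ} (m : Fin 2 → ℝ) (σ : Config n) : ℝ :=
  ∏ i : Particle n, (1 + m i.1 * spin σ i) / 2

lemma spin_eq {n : Fin 2 → ℕ} (σ : Config n) (i : Particle n) :
    spin σ i = 1 ∨ spin σ i = -1 := by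
  rcases Int.units_eq_one_or (σ i) with h | h <;> simp [spin, h]

lemma abs_spin {n : Fin 2 → ℕ} (σ : Config n) (i : Particle n) : |spin σ i| = 1 := by
  rcases spin_eq σ i with h | h <;> simp [h]

/-- The sum over configurations factorizes over particles. Taking `A` empty, a singleton or a pair
yields the total mass, the means and the mixed moment. -/
lemma sum_weight_mul_prod {n : Fin 2 → ℕ} (m : Fin 2 → ℝ) (A : Finset (Particle n)) :
    ∑ σ : Config n, weight m σ * ∏ i ∈ A, spin σ i = ∏ i ∈ A, m i.1 := by
  classical
  have h : ∀ σ : Config n, weight m σ * ∏ i ∈ A, spin σ i =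
      ∏ i, ((1 + m i.1 * ((σ i : ℤ) : ℝ)) / 2 * if i ∈ A then ((σ i : ℤ) : ℝ) else 1) := by
    intro σ
    rw [Finset.prod_mul_distrib]
    simp [weight, spin, Finset.prod_ite_mem]
  simp_rw [h]
  rw [← Fintype.prod_sum (fun (i : Particle n) (s : ℤˣ) =>
    ((1 + m i.1 * ((s : ℤ) : ℝ)) / 2 * if i ∈ A then ((s : ℤ) : ℝ) else 1))]
  have h2 : ∀ i : Particle n, (∑ s : ℤˣ,
      ((1 + m i.1 * ((s : ℤ) : ℝ)) / 2 * if i ∈ A then ((s : ℤ) : ℝ) else 1)) =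
      if i ∈ A then m i.1 else 1 := by
    intro i
    rw [show (Finset.univ : Finset ℤˣ) = {1, -1} from rfl, Finset.sum_pair (by decide)]
    split_ifs <;> push_cast <;> ring
  simp_rw [h2]
  simp [Finset.prod_ite_mem]

lemma sum_weight {n : Fin 2 → ℕ} (m : Fin 2 → ℝ) : ∑ σ : Config n, weight m σ = 1 := by
  simpa using sum_weight_mul_prod (n := n) m ∅

lemma weight_nonneg {n : Fin 2 → ℕ} {m : Fin 2 → ℝ} (hm : ∀ l, |m l| ≤ 1) (σ : Config n) :
    0 ≤ weight m σ := by
  refine Finset.prod_nonneg fun i _ => ?_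
  have := abs_le.1 (hm i.1)
  rcases spin_eq σ i with h | h <;> rw [h] <;> linarith [this.1, this.2]

lemma sum_weight_mul_magnetization {n : Fin 2 → ℕ} (m : Fin 2 → ℝ) (l : Fin 2) (hn : n l ≠ 0) :
    ∑ σ : Config n, weight m σ * magnetization σ l = m l := by
  have h : ∀ i : Fin (n l), ∑ σ : Config n, weight m σ * spin σ ⟨l, i⟩ = m l := fun i => by
    simpa using sum_weight_mul_prod (n := n) m {⟨l, i⟩}
  simp_rw [magnetization, mul_div_assoc', Finset.mul_sum]
  rw [← Finset.sum_div, Finset.sum_comm]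
  simp_rw [h]
  have : (n l : ℝ) ≠ 0 := by exact_mod_cast hn
  simp [this]

lemma sum_weight_mul_magnetization_mul {n : Fin 2 → ℕ} (m : Fin 2 → ℝ) (hn : ∀ l, n l ≠ 0) :
    ∑ σ : Config n, weight m σ * (magnetization σ 0 * magnetization σ 1) = m 0 * m 1 := by
  have h : ∀ (i : Fin (n 0)) (j : Fin (n 1)),
      ∑ σ : Config n, weight m σ * (spin σ ⟨0, i⟩ * spin σ ⟨1, j⟩) = m 0 * m 1 := fun i j => by
    have := sum_weight_mul_prod (n := n) m {⟨0, i⟩, ⟨1, j⟩}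
    have hne : (⟨0, i⟩ : Particle n) ≠ ⟨1, j⟩ := fun h => by
      simpa using congrArg Sigma.fst h
    simpa [Finset.prod_pair hne] using this
  have h0 : (n 0 : ℝ) ≠ 0 := by exact_mod_cast hn 0
  have h1 : (n 1 : ℝ) ≠ 0 := by exact_mod_cast hn 1
  have e : ∀ σ : Config n, weight m σ * (magnetization σ 0 * magnetization σ 1) =
      (∑ i : Fin (n 0), ∑ j : Fin (n 1), weight m σ * (spin σ ⟨0, i⟩ * spin σ ⟨1, j⟩)) /
        (n 0 * n 1) := by
    intro σ
    simp_rw [magnetization, div_mul_div_comm, Finset.sum_mul_sum, mul_div_assoc', Finset.mul_sum]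
  simp_rw [e]
  rw [← Finset.sum_div, Finset.sum_comm]
  have e2 : ∀ i : Fin (n 0), ∑ σ : Config n, ∑ j : Fin (n 1),
      weight m σ * (spin σ ⟨0, i⟩ * spin σ ⟨1, j⟩) = n 1 * (m 0 * m 1) := by
    intro i
    rw [Finset.sum_comm]
    simp_rw [h]
    simp
  simp_rw [e2]
  simp
  field_simp

/-- Nonnegativity of the variance. A one-sided bound is enough, since it will be multiplied by `J l
l ≥ 0`. -/
lemma sq_le_sum_weight_mul_magnetization_sq {n : Fin 2 → ℕ} {m : Fin 2 → ℝ}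
    (hm : ∀ l, |m l| ≤ 1) (l : Fin 2) (hn : n l ≠ 0) :
    m l ^ 2 ≤ ∑ σ : Config n, weight m σ * magnetization σ l ^ 2 := by
  have h : 0 ≤ ∑ σ : Config n, weight m σ * (magnetization σ l - m l) ^ 2 :=
    Finset.sum_nonneg fun σ _ => mul_nonneg (weight_nonneg hm σ) (sq_nonneg _)
  have e : ∑ σ : Config n, weight m σ * (magnetization σ l - m l) ^ 2 =
      ∑ σ : Config n, weight m σ * magnetization σ l ^ 2
        - 2 * m l * ∑ σ : Config n, weight m σ * magnetization σ l
        + m l ^ 2 * ∑ σ : Config n, weight m σ := by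
    rw [Finset.mul_sum, Finset.mul_sum, ← Finset.sum_sub_distrib, ← Finset.sum_add_distrib]
    exact Finset.sum_congr rfl fun σ _ => by ring
  rw [e, sum_weight_mul_magnetization m l hn, sum_weight] at h
  linarith

lemma abs_magnetization_le {n : Fin 2 → ℕ} (σ : Config n) (l : Fin 2) :
    |magnetization σ l| ≤ 1 := by
  rw [magnetization, abs_div, Nat.abs_cast]
  refine div_le_one_of_le₀ ?_ (Nat.cast_nonneg _)
  refine (Finset.abs_sum_le_sum_abs _ _).trans ?_
  simp [abs_spin]

/-! ### Entropy of the product measures -/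

lemma entropy_sub_log_two (x : ℝ) :
    (1 + x) / 2 * Real.log ((1 + x) / 2) + (1 - x) / 2 * Real.log ((1 - x) / 2) =
      entropy x - Real.log 2 := by
  have h : ∀ y : ℝ, y / 2 * Real.log (y / 2) = y / 2 * Real.log y - y / 2 * Real.log 2 := by
    intro y
    rcases eq_or_ne y 0 with rfl | hy
    · simp
    · rw [Real.log_div hy two_ne_zero]; ring
  rw [h, h, entropy]; ring

/-- Any function of a `±1` variable is affine in it, so the logarithmic weight depends on `σ` only
through its magnetizations. -/
lemma sum_log_weight {n : Fin 2 → ℕ} (m : Fin 2 → ℝ) (σ : Config n) :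
    ∑ i : Particle n, Real.log ((1 + m i.1 * spin σ i) / 2) =
      ∑ l, n l * ((1 + magnetization σ l) / 2 * Real.log ((1 + m l) / 2)
        + (1 - magnetization σ l) / 2 * Real.log ((1 - m l) / 2)) := by
  rw [Fintype.sum_sigma]
  refine Finset.sum_congr rfl fun l _ => ?_
  have h : ∀ i : Fin (n l), Real.log ((1 + m l * spin σ ⟨l, i⟩) / 2) =
      (Real.log ((1 + m l) / 2) + Real.log ((1 - m l) / 2)) / 2
      + spin σ ⟨l, i⟩ * ((Real.log ((1 + m l) / 2) - Real.log ((1 - m l) / 2)) / 2) := by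
    intro i
    rcases spin_eq σ ⟨l, i⟩ with h | h <;> rw [h]
    · rw [mul_one]; ring
    · rw [show 1 + m l * -1 = 1 - m l by ring]; ring
  have hs : ∑ i : Fin (n l), spin σ ⟨l, i⟩ = n l * magnetization σ l := by
    rw [magnetization]
    rcases Nat.eq_zero_or_pos (n l) with h0 | h0
    · have : IsEmpty (Fin (n l)) := by rw [h0]; infer_instance
      simp
    · field_simp
  simp_rw [h]
  rw [Finset.sum_add_distrib, ← Finset.sum_mul, hs]
  simp
  ring

lemma weight_eq_exp {n : Fin 2 → ℕ} {m : Fin 2 → ℝ} {σ : Config n}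
    (h : ∀ i : Particle n, 0 < 1 + m i.1 * spin σ i) :
    weight m σ = Real.exp (∑ i : Particle n, Real.log ((1 + m i.1 * spin σ i) / 2)) := by
  rw [Real.exp_sum]
  exact Finset.prod_congr rfl fun i _ => (Real.exp_log (half_pos (h i))).symm

/-- This is an average of the terms `1 + σ_j σ_i ≥ 0`, and the term `j = i` equals `2`. Hence a
configuration has positive weight under its own product measure, even when a magnetization is `±1`.
-/
lemma one_add_magnetization_mul_spin_pos {n : Fin 2 → ℕ} (σ : Config n) (i : Particle n) :
    0 < 1 + magnetization σ i.1 * spin σ i := by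
  obtain ⟨l, i⟩ := i
  have hn : 0 < (n l : ℝ) := by exact_mod_cast i.pos
  have e : 1 + magnetization σ l * spin σ ⟨l, i⟩ =
      (∑ j : Fin (n l), (1 + spin σ ⟨l, j⟩ * spin σ ⟨l, i⟩)) / n l := by
    rw [Finset.sum_add_distrib, ← Finset.sum_mul, magnetization]
    simp
    field_simp
  simp only
  rw [e]
  refine div_pos (Finset.sum_pos' (fun j _ => ?_) ⟨i, Finset.mem_univ _, ?_⟩) hn
  · rcases spin_eq σ ⟨l, i⟩ with h | h <;> rcases spin_eq σ ⟨l, j⟩ with h' | h' <;>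
      rw [h, h'] <;> norm_num
  · rcases spin_eq σ ⟨l, i⟩ with h | h <;> rw [h] <;> norm_num

lemma card_image_magnetization_le (k : ℕ) :
    (Finset.univ.image fun σ : Config (fun _ => k) => magnetization σ).card ≤ (2 * k + 1) ^ 2 := by
  have hsub : (Finset.univ.image fun σ : Config (fun _ => k) => magnetization σ) ⊆
      (Fintype.piFinset fun _ : Fin 2 => Finset.Icc (-(k : ℤ)) k).image
        (fun z l => (z l : ℝ) / k) := by
    intro m hm
    obtain ⟨σ, -, rfl⟩ := Finset.mem_image.1 hm
    refine Finset.mem_image.2 ⟨fun l => ∑ i : Fin k, (σ ⟨l, i⟩ : ℤ), ?_, ?_⟩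
    · refine Fintype.mem_piFinset.2 fun l => Finset.mem_Icc.2 (abs_le.1 ?_)
      refine (Finset.abs_sum_le_sum_abs _ _).trans ?_
      have h1 : ∀ i : Fin k, |(σ ⟨l, i⟩ : ℤ)| = 1 := fun i => by
        rcases Int.units_eq_one_or (σ ⟨l, i⟩) with h | h <;> simp [h]
      simp_rw [h1]
      simp
    · funext l
      simp [magnetization, spin]
  refine (Finset.card_le_card hsub).trans (Finset.card_image_le.trans ?_)
  rw [Fintype.card_piFinset_const]
  simp
  refine Nat.pow_le_pow_left ?_ 2
  omega

/-! ### The pressure in the thermodynamic limit -/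

/-- The identity is exact, without an error term, because the Hamiltonian includes the
self-interactions `i = j`. -/
lemma neg_mul_hamiltonian (β : ℝ) {J : Matrix (Fin 2) (Fin 2) ℝ} (hJ : J 1 0 = J 0 1)
    (h : Fin 2 → ℝ) {k : ℕ} (hk : k ≠ 0) (σ : Config fun _ => k) :
    -β * hamiltonian J h (fun _ => k) σ =
      2 * k * (β * energy half J h (magnetization σ)) := by
  have hk' : (k : ℝ) ≠ 0 := by exact_mod_cast hk
  have hs : ∀ l, ∑ i : Fin k, spin σ ⟨l, i⟩ = k * magnetization σ l := by
    intro l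
    rw [magnetization]
    field_simp
  have h1 : ∑ i : Particle (fun _ => k), h i.1 * spin σ i =
      h 0 * (k * magnetization σ 0) + h 1 * (k * magnetization σ 1) := by
    rw [Fintype.sum_sigma, Fin.sum_univ_two, ← hs, ← hs, Finset.mul_sum, Finset.mul_sum]
  have h2 : ∑ i : Particle (fun _ => k), ∑ j : Particle (fun _ => k),
      J i.1 j.1 * spin σ i * spin σ j =
      ∑ a, ∑ b, J a b * (k * magnetization σ a) * (k * magnetization σ b) := by
    rw [Fintype.sum_sigma]
    refine Finset.sum_congr rfl fun a _ => ?_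
    simp_rw [Fintype.sum_sigma]
    rw [Finset.sum_comm]
    refine Finset.sum_congr rfl fun b _ => ?_
    rw [← hs a, ← hs b, mul_assoc (J a b), Finset.sum_mul_sum, Finset.mul_sum]
    simp_rw [Finset.mul_sum, mul_assoc]
  rw [hamiltonian, h1, h2]
  simp only [Fin.sum_univ_two, hJ, energy, half, size]
  push_cast
  field_simp
  ring

lemma partitionFunction_pos (β : ℝ) (J : Matrix (Fin 2) (Fin 2) ℝ) (h : Fin 2 → ℝ)
    (n : Fin 2 → ℕ) : 0 < partitionFunction β J h n :=
  Finset.sum_pos (fun _ _ => Real.exp_pos _) ⟨fun _ => 1, Finset.mem_univ _⟩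

/-- At its own magnetization the weight of `σ` is the exponential of minus the entropy, so `M`
bounds each Boltzmann factor relative to it. Each product measure has mass one, so these weights sum
to at most the number of magnetization values. -/
lemma partitionFunction_le {β M : ℝ} {J : Matrix (Fin 2) (Fin 2) ℝ} (hJ : J 1 0 = J 0 1)
    {h : Fin 2 → ℝ} (hM : ∀ ν ∈ Set.Icc (-1 : Fin 2 → ℝ) 1, functional β half J h ν ≤ M)
    {k : ℕ} (hk : k ≠ 0) :
    partitionFunction β J h (fun _ => k) ≤
      Real.exp (2 * k * (Real.log 2 + M)) * (2 * k + 1) ^ 2 := by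
  classical
  have hterm : ∀ σ : Config (fun _ => k), Real.exp (-β * hamiltonian J h (fun _ => k) σ) ≤
      Real.exp (2 * k * (Real.log 2 + M)) * weight (magnetization σ) σ := by
    intro σ
    rw [weight_eq_exp (one_add_magnetization_mul_spin_pos σ), ← Real.exp_add,
      neg_mul_hamiltonian β hJ h hk, sum_log_weight, Real.exp_le_exp]
    simp_rw [entropy_sub_log_two]
    have := hM (magnetization σ) ⟨fun l => (abs_le.1 (abs_magnetization_le σ l)).1,
      fun l => (abs_le.1 (abs_magnetization_le σ l)).2⟩
    rw [functional] at this
    rw [Fin.sum_univ_two]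
    simp only [half] at this ⊢
    have hk' : (0 : ℝ) ≤ 2 * k := by positivity
    nlinarith [mul_le_mul_of_nonneg_left this hk']
  have hw : ∑ σ : Config (fun _ => k), weight (magnetization σ) σ ≤ (2 * k + 1) ^ 2 := by
    set I := Finset.univ.image fun σ : Config (fun _ => k) => magnetization σ with hI
    have hm : ∀ m ∈ I, ∀ l, |m l| ≤ 1 := by
      intro m hm
      obtain ⟨σ, -, rfl⟩ := Finset.mem_image.1 hm
      exact abs_magnetization_le σ
    calc ∑ σ : Config (fun _ => k), weight (magnetization σ) σ
        ≤ ∑ σ : Config (fun _ => k), ∑ m ∈ I, weight m σ :=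
          Finset.sum_le_sum fun σ _ => Finset.single_le_sum (f := fun m => weight m σ)
            (fun m h => weight_nonneg (hm m h) σ) (Finset.mem_image_of_mem _ (Finset.mem_univ σ))
      _ = I.card := by
          rw [Finset.sum_comm]
          simp_rw [sum_weight]
          simp
      _ ≤ (2 * k + 1) ^ 2 := by exact_mod_cast card_image_magnetization_le k
  calc partitionFunction β J h (fun _ => k)
      ≤ ∑ σ : Config (fun _ => k),
          Real.exp (2 * k * (Real.log 2 + M)) * weight (magnetization σ) σ :=
        Finset.sum_le_sum fun σ _ => hterm σ
    _ = Real.exp (2 * k * (Real.log 2 + M)) *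
          ∑ σ : Config (fun _ => k), weight (magnetization σ) σ := by rw [Finset.mul_sum]
    _ ≤ _ := mul_le_mul_of_nonneg_left hw (Real.exp_nonneg _)

/-- Gibbs' variational principle: Jensen's inequality for `exp` under the product measure with means
`m`. The strict bound on `m` keeps all weights positive. -/
lemma le_log_partitionFunction {β : ℝ} (hβ : 0 ≤ β) {J : Matrix (Fin 2) (Fin 2) ℝ}
    (hJ : J 1 0 = J 0 1) (hJ₀ : 0 ≤ J 0 0) (hJ₁ : 0 ≤ J 1 1) (h : Fin 2 → ℝ) {m : Fin 2 → ℝ}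
    (hm : ∀ l, |m l| < 1) {k : ℕ} (hk : k ≠ 0) :
    2 * k * (Real.log 2 + functional β half J h m) ≤
      Real.log (partitionFunction β J h (fun _ => k)) := by
  have hpos : ∀ σ : Config (fun _ => k), ∀ i : Particle (fun _ => k),
      0 < 1 + m i.1 * spin σ i := by
    intro σ i
    have := abs_lt.1 (hm i.1)
    rcases spin_eq σ i with h | h <;> rw [h] <;> linarith [this.1, this.2]
  rw [Real.le_log_iff_exp_le (partitionFunction_pos _ _ _ _)]
  set Φ : Config (fun _ => k) → ℝ := fun σ =>
    -β * hamiltonian J h (fun _ => k) σ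
      - ∑ i : Particle (fun _ => k), Real.log ((1 + m i.1 * spin σ i) / 2) with hΦ
  have hZ : partitionFunction β J h (fun _ => k) =
      ∑ σ : Config (fun _ => k), weight m σ • Real.exp (Φ σ) := by
    refine Finset.sum_congr rfl fun σ _ => ?_
    rw [smul_eq_mul, weight_eq_exp (hpos σ), ← Real.exp_add]
    congr 1
    simp only [hΦ]; ring
  have hjensen := convexOn_exp.map_sum_le (t := (Finset.univ : Finset (Config fun _ => k)))
    (w := weight m) (p := Φ) (fun σ _ => weight_nonneg (fun l => (hm l).le) σ) (sum_weight m)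
    (fun σ _ => Set.mem_univ _)
  rw [hZ]
  refine le_trans (Real.exp_le_exp.2 ?_) hjensen
  have hn : ∀ l : Fin 2, (fun _ : Fin 2 => k) l ≠ 0 := fun _ => hk
  have e1 := fun l => sum_weight_mul_magnetization (n := fun _ => k) m l hk
  have e2 := sum_weight_mul_magnetization_mul (n := fun _ => k) m hn
  have e3 := fun l =>
    sq_le_sum_weight_mul_magnetization_sq (n := fun _ => k) (fun l => (hm l).le) l hk
  have e0 := sum_weight (n := fun _ => k) m
  set P : Fin 2 → ℝ := fun l => Real.log ((1 + m l) / 2)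
  set Q : Fin 2 → ℝ := fun l => Real.log ((1 - m l) / 2)
  have hexp : ∑ σ : Config (fun _ => k), weight m σ • Φ σ =
      2 * k * β * (1 / 8 * J 0 0 * (∑ σ : Config (fun _ => k), weight m σ * magnetization σ 0 ^ 2)
        + 1 / 8 * J 1 1 * (∑ σ : Config (fun _ => k), weight m σ * magnetization σ 1 ^ 2)
        + 1 / 4 * J 0 1 * (∑ σ : Config (fun _ => k),
            weight m σ * (magnetization σ 0 * magnetization σ 1)))
      + (k * β * h 0 - k * (P 0 - Q 0) / 2) *
          (∑ σ : Config (fun _ => k), weight m σ * magnetization σ 0)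
      + (k * β * h 1 - k * (P 1 - Q 1) / 2) *
          (∑ σ : Config (fun _ => k), weight m σ * magnetization σ 1)
      - k * (P 0 + Q 0 + P 1 + Q 1) / 2 * ∑ σ : Config (fun _ => k), weight m σ := by
    simp_rw [Finset.mul_sum, ← Finset.sum_add_distrib, Finset.mul_sum,
      ← Finset.sum_add_distrib, ← Finset.sum_sub_distrib]
    refine Finset.sum_congr rfl fun σ _ => ?_
    simp only [hΦ, smul_eq_mul]
    rw [neg_mul_hamiltonian β hJ h hk, sum_log_weight, Fin.sum_univ_two]
    simp only [energy, half, P, Q]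
    ring
  rw [hexp, e1, e1, e2, e0]
  have f0 := entropy_sub_log_two (m 0)
  have f1 := entropy_sub_log_two (m 1)
  have q0 : entropy (m 0) = (1 + m 0) / 2 * P 0 + (1 - m 0) / 2 * Q 0 + Real.log 2 := by
    simp only [P, Q]; linarith
  have q1 : entropy (m 1) = (1 + m 1) / 2 * P 1 + (1 - m 1) / 2 * Q 1 + Real.log 2 := by
    simp only [P, Q]; linarith
  rw [functional, q0, q1, energy]
  simp only [half]
  have g0 := mul_le_mul_of_nonneg_left (e3 0) (by positivity : 0 ≤ 2 * k * β * (1 / 8 * J 0 0))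
  have g1 := mul_le_mul_of_nonneg_left (e3 1) (by positivity : 0 ≤ 2 * k * β * (1 / 8 * J 1 1))
  linarith

lemma continuous_entropy : Continuous entropy := by
  unfold entropy
  have h := Real.continuous_mul_log
  have h1 : Continuous fun x : ℝ => (1 + x) * Real.log (1 + x) :=
    h.comp (continuous_const.add continuous_id)
  have h2 : Continuous fun x : ℝ => (1 - x) * Real.log (1 - x) :=
    h.comp (continuous_const.sub continuous_id)
  exact continuous_const.mul (h1.add h2)

lemma continuous_functional (β : ℝ) (α : Fin 2 → ℝ) (J : Matrix (Fin 2) (Fin 2) ℝ)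
    (h : Fin 2 → ℝ) : Continuous (functional β α J h) := by
  have h0 : Continuous fun μ : Fin 2 → ℝ => entropy (μ 0) :=
    continuous_entropy.comp (continuous_apply 0)
  have h1 : Continuous fun μ : Fin 2 → ℝ => entropy (μ 1) :=
    continuous_entropy.comp (continuous_apply 1)
  unfold functional energy
  fun_prop

/-- The pressure converges to `ln 2` plus the maximum of the pressure functional. -/
theorem tendsto_pressure {β : ℝ} (hβ : 0 ≤ β) {J : Matrix (Fin 2) (Fin 2) ℝ}
    (hJ : J 1 0 = J 0 1) (hJ₀ : 0 ≤ J 0 0) (hJ₁ : 0 ≤ J 1 1) {h m : Fin 2 → ℝ}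
    (hm : m ∈ states β half J h) :
    Tendsto (fun k : ℕ => pressure β J h (fun _ => k)) atTop
      (𝓝 (Real.log 2 + functional β half J h m)) := by
  set L := Real.log 2 + functional β half J h m with hL
  -- A maximum point might lie on the boundary, where the Jensen bound is not available, so it is
  -- approached by `r • m` with `r ↑ 1`.
  have hlow : ∀ k : ℕ, k ≠ 0 → 2 * k * L ≤ Real.log (partitionFunction β J h (fun _ => k)) := by
    intro k hk
    have hc : ContinuousWithinAt
        (fun r : ℝ => 2 * k * (Real.log 2 + functional β half J h (r • m))) (Set.Iio 1) 1 := by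
      have := (continuous_functional β half J h).comp (continuous_id.smul continuous_const :
        Continuous fun r : ℝ => r • m)
      exact (continuous_const.mul (continuous_const.add this)).continuousWithinAt
    have hc' : Tendsto (fun r : ℝ => 2 * k * (Real.log 2 + functional β half J h (r • m)))
        (𝓝[<] 1) (𝓝 (2 * k * L)) := by
      have h1 : (1 : ℝ) • m = m := one_smul _ _
      simpa only [ContinuousWithinAt, hL, h1] using hc
    refine le_of_tendsto hc' ?_
    filter_upwards [Ioo_mem_nhdsLT (show (0 : ℝ) < 1 by norm_num)] with r hr
    refine le_log_partitionFunction hβ hJ hJ₀ hJ₁ h (fun l => ?_) hk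
    have hml : |m l| ≤ 1 := abs_le.2 ⟨hm.1.1 l, hm.1.2 l⟩
    rw [Pi.smul_apply, smul_eq_mul, abs_mul, abs_of_pos hr.1]
    nlinarith [hr.1, hr.2, abs_nonneg (m l)]
  have hup : ∀ k : ℕ, k ≠ 0 → Real.log (partitionFunction β J h (fun _ => k)) ≤
      2 * k * L + 2 * Real.log (2 * k + 1) := by
    intro k hk
    refine (Real.log_le_log (partitionFunction_pos _ _ _ _)
      (partitionFunction_le hJ hm.2 hk)).trans_eq ?_
    rw [Real.log_mul (Real.exp_ne_zero _) (by positivity), Real.log_exp, Real.log_pow]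
    norm_num [hL]
  have hlog : Tendsto (fun k : ℕ => L + 2 * (Real.log (2 * k + 1) / (2 * k))) atTop (𝓝 L) := by
    have hx : Tendsto (fun k : ℕ => (2 * (k : ℝ) + 1)) atTop atTop :=
      tendsto_atTop_add_const_right _ _
        (tendsto_natCast_atTop_atTop.const_mul_atTop two_pos)
    -- With `x = 2k + 1` the denominator `x - 1` is `2k`.
    have h1 : Tendsto (fun x : ℝ => Real.log x ^ 1 / (1 * x + -1)) atTop (𝓝 0) :=
      Real.tendsto_pow_log_div_mul_add_atTop 1 (-1) 1 one_ne_zero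
    have h2 := h1.comp hx
    have h3 : Tendsto (fun k : ℕ => Real.log (2 * k + 1) / (2 * k)) atTop (𝓝 0) := by
      refine h2.congr fun k => ?_
      simp
    simpa using (h3.const_mul 2).const_add L
  refine tendsto_of_tendsto_of_tendsto_of_le_of_le' tendsto_const_nhds hlog ?_ ?_
  · filter_upwards [eventually_ne_atTop 0] with k hk
    have hk' : (0 : ℝ) < 2 * k := by positivity
    rw [pressure, size, one_div_mul_eq_div, le_div_iff₀ (by push_cast; linarith)]
    push_cast
    linarith [hlow k hk]
  · filter_upwards [eventually_ne_atTop 0] with k hk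
    have hk' : (0 : ℝ) < 2 * k := by positivity
    rw [pressure, size, one_div_mul_eq_div, div_le_iff₀ (by push_cast; linarith)]
    have := hup k hk
    have e : (L + 2 * (Real.log (2 * k + 1) / (2 * k))) * ((k + k : ℕ) : ℝ) =
        2 * k * L + 2 * Real.log (2 * k + 1) := by
      push_cast
      field_simp
      ring
    linarith

/-! ### The one-population functional -/

/-- The function `K x² / 2 - I(x)`, to which the functional reduces on each coordinate. -/
def landau (K x : ℝ) : ℝ := K / 2 * x ^ 2 - entropy x

lemma entropy_neg (x : ℝ) : entropy (-x) = entropy x := by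
  simp only [entropy, sub_neg_eq_add, ← sub_eq_add_neg]; ring

lemma landau_neg (K x : ℝ) : landau K (-x) = landau K x := by
  simp only [landau, entropy_neg, neg_sq]

lemma landau_abs (K x : ℝ) : landau K |x| = landau K x := by
  rcases abs_choice x with h | h <;> rw [h]
  exact landau_neg K x

@[simp] lemma landau_zero (K : ℝ) : landau K 0 = 0 := by simp [landau, entropy]

lemma continuous_landau (K : ℝ) : Continuous (landau K) := by
  unfold landau
  exact (by fun_prop : Continuous fun x : ℝ => K / 2 * x ^ 2).sub continuous_entropy

lemma entropy_le_sq {x : ℝ} (hx : x ∈ Set.Ioo (-1 : ℝ) 1) : entropy x ≤ x ^ 2 := by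
  have h1 := Real.log_le_sub_one_of_pos (show 0 < 1 + x by linarith [hx.1])
  have h2 := Real.log_le_sub_one_of_pos (show 0 < 1 - x by linarith [hx.2])
  have g1 := mul_le_mul_of_nonneg_left h1 (show 0 ≤ 1 + x by linarith [hx.1])
  have g2 := mul_le_mul_of_nonneg_left h2 (show 0 ≤ 1 - x by linarith [hx.2])
  rw [entropy]
  nlinarith

lemma hasDerivAt_entropy {x : ℝ} (hx : x ∈ Set.Ioo (-1 : ℝ) 1) :
    HasDerivAt entropy (Real.artanh x) x := by
  have h1 : 1 + x ≠ 0 := by linarith [hx.1]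
  have h2 : 1 - x ≠ 0 := by linarith [hx.2]
  have d1 : HasDerivAt (fun y : ℝ => 1 + y) 1 x := (hasDerivAt_id x).const_add 1
  have d2 : HasDerivAt (fun y : ℝ => 1 - y) (-1) x := (hasDerivAt_id x).const_sub 1
  have := ((d1.mul (d1.log h1)).add (d2.mul (d2.log h2))).const_mul (1 / 2)
  refine this.congr_deriv ?_
  rw [Real.artanh_eq_half_log ⟨hx.1.le, hx.2.le⟩, Real.log_div h1 h2]
  field_simp
  ring

lemma hasDerivAt_artanh {x : ℝ} (hx : x ∈ Set.Ioo (-1 : ℝ) 1) :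
    HasDerivAt Real.artanh (1 / (1 - x ^ 2)) x := by
  have h1 : 1 + x ≠ 0 := by linarith [hx.1]
  have h2 : 1 - x ≠ 0 := by linarith [hx.2]
  have h3 : 1 - x ^ 2 ≠ 0 := by
    rw [show 1 - x ^ 2 = (1 + x) * (1 - x) by ring]; exact mul_ne_zero h1 h2
  have d1 : HasDerivAt (fun y : ℝ => 1 + y) 1 x := (hasDerivAt_id x).const_add 1
  have d2 : HasDerivAt (fun y : ℝ => 1 - y) (-1) x := (hasDerivAt_id x).const_sub 1
  have := ((d1.log h1).sub (d2.log h2)).const_mul (1 / 2)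
  refine (this.congr_of_eventuallyEq ?_).congr_deriv ?_
  · filter_upwards [Ioo_mem_nhds hx.1 hx.2] with y hy
    rw [Real.artanh_eq_half_log ⟨hy.1.le, hy.2.le⟩, Real.log_div (by linarith [hy.1])
      (by linarith [hy.2])]
    rfl
  · field_simp
    ring

lemma artanh_neg_eq (x : ℝ) (hx : x ∈ Set.Ioo (-1 : ℝ) 1) :
    Real.artanh (-x) = -Real.artanh x := by
  have : Real.tanh (-Real.artanh x) = -x := by rw [Real.tanh_neg, Real.tanh_artanh hx]
  rw [← this, Real.artanh_tanh]

/-- The derivative of `landau K` on `(-1, 1)`. -/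
def landauDeriv (K x : ℝ) : ℝ := K * x - Real.artanh x

lemma hasDerivAt_landau (K : ℝ) {x : ℝ} (hx : x ∈ Set.Ioo (-1 : ℝ) 1) :
    HasDerivAt (landau K) (landauDeriv K x) x := by
  have := (((hasDerivAt_id x).pow 2).const_mul (K / 2)).sub (hasDerivAt_entropy hx)
  refine this.congr_deriv ?_
  simp [landauDeriv]
  ring

lemma hasDerivAt_landauDeriv (K : ℝ) {x : ℝ} (hx : x ∈ Set.Ioo (-1 : ℝ) 1) :
    HasDerivAt (landauDeriv K) (K - 1 / (1 - x ^ 2)) x := by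
  have := ((hasDerivAt_id x).const_mul K).sub (hasDerivAt_artanh hx)
  exact this.congr_deriv (by simp)

lemma landauDeriv_neg (K : ℝ) {x : ℝ} (hx : x ∈ Set.Ioo (-1 : ℝ) 1) :
    landauDeriv K (-x) = -landauDeriv K x := by
  rw [landauDeriv, landauDeriv, artanh_neg_eq x hx]; ring

@[simp] lemma landauDeriv_zero (K : ℝ) : landauDeriv K 0 = 0 := by simp [landauDeriv]

lemma continuousOn_landauDeriv (K : ℝ) : ContinuousOn (landauDeriv K) (Set.Ioo (-1) 1) :=
  fun _ hx => (hasDerivAt_landauDeriv K hx).continuousAt.continuousWithinAt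

/-- The derivative `K - 1/(1 - x²)` is negative for `x > r`, because `K (1 - x²) < K (1 - r²) ≤ 1`.
-/
lemma strictAntiOn_landauDeriv {K r : ℝ} (hr : 0 ≤ r) (hK : K * (1 - r ^ 2) ≤ 1) (hK₀ : 0 < K) :
    StrictAntiOn (landauDeriv K) (Set.Ico r 1) := by
  refine strictAntiOn_of_deriv_neg (convex_Ico r 1)
    ((continuousOn_landauDeriv K).mono fun x hx => ⟨by linarith [hx.1], hx.2⟩) fun x hx => ?_
  rw [interior_Ico] at hx
  have hx' : x ∈ Set.Ioo (-1 : ℝ) 1 := ⟨by linarith [hx.1], hx.2⟩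
  rw [(hasDerivAt_landauDeriv K hx').deriv, sub_neg, lt_div_iff₀ (by nlinarith [hx'.1, hx'.2])]
  nlinarith [hx.1, mul_pos hK₀ (show 0 < x ^ 2 - r ^ 2 by nlinarith [hx.1])]

lemma strictConcaveOn_landau {K r : ℝ} (hr : 0 ≤ r) (hK : K * (1 - r ^ 2) ≤ 1) (hK₀ : 0 < K) :
    StrictConcaveOn ℝ (Set.Icc r 1) (landau K) := by
  refine StrictAntiOn.strictConcaveOn_of_deriv (convex_Icc r 1)
    (continuous_landau K).continuousOn ?_
  rw [interior_Icc]
  refine ((strictAntiOn_landauDeriv hr hK hK₀).mono Set.Ioo_subset_Ico_self).congr fun x hx => ?_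
  exact (hasDerivAt_landau K ⟨by linarith [hx.1], hx.2⟩).deriv.symm

/-- The case `r = 0` covers `[0, 1)`; oddness of the derivative carries it to `(-1, 0]`, and the two
halves are glued at `0`. -/
lemma strictConcaveOn_landau_of_le_one {K : ℝ} (hK₀ : 0 < K) (hK : K ≤ 1) :
    StrictConcaveOn ℝ (Set.Icc (-1) 1) (landau K) := by
  refine StrictAntiOn.strictConcaveOn_of_deriv (convex_Icc _ 1)
    (continuous_landau K).continuousOn ?_
  rw [interior_Icc]
  have h := strictAntiOn_landauDeriv (K := K) le_rfl (by linarith) hK₀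
  have h' : StrictAntiOn (landauDeriv K) (Set.Ioc (-1) 0) := by
    intro x hx y hy hxy
    have := h (a := -y) (b := -x) ⟨by linarith [hy.2], by linarith [hy.1]⟩
      ⟨by linarith [hx.2], by linarith [hx.1]⟩ (by linarith)
    rw [landauDeriv_neg K ⟨hx.1, by linarith [hx.2]⟩,
      landauDeriv_neg K ⟨hy.1, by linarith [hy.2]⟩] at this
    linarith
  have hu := h'.union h (c := 0) ⟨⟨by norm_num, le_rfl⟩, fun x hx => hx.2⟩
    ⟨⟨le_rfl, one_pos⟩, fun x hx => hx.1⟩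
  rw [Set.Ioc_union_Ico_eq_Ioo (by norm_num) (by norm_num)] at hu
  exact hu.congr fun x hx => (hasDerivAt_landau K hx).deriv.symm

lemma landau_neg_of_le_one {K : ℝ} (hK₀ : 0 < K) (hK : K ≤ 1) {x : ℝ}
    (hx : x ∈ Set.Icc (-1 : ℝ) 1) (hx₀ : x ≠ 0) : landau K x < 0 := by
  have h := (strictConcaveOn_landau_of_le_one hK₀ hK).2 hx
    (show -x ∈ Set.Icc (-1 : ℝ) 1 from ⟨by linarith [hx.2], by linarith [hx.1]⟩)
    (fun h => hx₀ (by linarith)) (by norm_num : (0 : ℝ) < 1 / 2) (by norm_num : (0 : ℝ) < 1 / 2)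
    (by norm_num)
  simp only [smul_eq_mul, landau_neg] at h
  rw [show 1 / 2 * x + 1 / 2 * -x = 0 by ring, landau_zero] at h
  linarith

lemma eq_tanh_iff (K y : ℝ) :
    y = Real.tanh (K * y) ↔ y ∈ Set.Ioo (-1 : ℝ) 1 ∧ landauDeriv K y = 0 := by
  constructor
  · intro h
    have hy : y ∈ Set.Ioo (-1 : ℝ) 1 := by
      rw [h]; exact ⟨Real.neg_one_lt_tanh _, Real.tanh_lt_one _⟩
    refine ⟨hy, ?_⟩
    rw [landauDeriv]
    nth_rewrite 2 [h]
    rw [Real.artanh_tanh, sub_self]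
  · rintro ⟨hy, h⟩
    rw [landauDeriv, sub_eq_zero] at h
    rw [h, Real.tanh_artanh hy]

/-- Above the critical coupling the one-population functional has exactly two maximum points
`±x`, which are the non-zero solutions of the mean-field equation, and it is strictly concave in
a neighbourhood of `x`. -/
lemma exists_landau_max {K : ℝ} (hK : 1 < K) :
    ∃ x r : ℝ, 0 ≤ r ∧ r < x ∧ x < 1 ∧ StrictConcaveOn ℝ (Set.Icc r 1) (landau K) ∧
      (∀ y : ℝ, y = Real.tanh (K * y) ↔ y = 0 ∨ y = x ∨ y = -x) ∧ 0 < landau K x ∧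
      ∀ y ∈ Set.Icc (-1 : ℝ) 1, landau K y ≤ landau K x ∧
        (landau K y = landau K x → y = x ∨ y = -x) := by
  have hK₀ : 0 < K := by linarith
  -- The inflection point of `landau K`, where `K (1 - r²) = 1`.
  set r := Real.sqrt (1 - K⁻¹) with hr
  have hKi : K⁻¹ < 1 := inv_lt_one_of_one_lt₀ hK
  have hKi0 : 0 < K⁻¹ := inv_pos.2 hK₀
  have hr2 : r ^ 2 = 1 - K⁻¹ := Real.sq_sqrt (by linarith)
  have hr0 : 0 < r := Real.sqrt_pos.2 (by linarith)
  have hr1 : r < 1 := by nlinarith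
  have hKr : K * (1 - r ^ 2) = 1 := by rw [hr2]; field_simp; ring
  have hanti := strictAntiOn_landauDeriv hr0.le hKr.le hK₀
  have hmono : StrictMonoOn (landauDeriv K) (Set.Icc 0 r) := by
    refine strictMonoOn_of_deriv_pos (convex_Icc 0 r)
      ((continuousOn_landauDeriv K).mono fun x hx => ⟨by linarith [hx.1], by linarith [hx.2]⟩)
      fun x hx => ?_
    rw [interior_Icc] at hx
    have hx' : x ∈ Set.Ioo (-1 : ℝ) 1 := ⟨by linarith [hx.1], by linarith [hx.2]⟩
    rw [(hasDerivAt_landauDeriv K hx').deriv, sub_pos, div_lt_iff₀ (by nlinarith [hx'.1, hx'.2])]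
    nlinarith [mul_pos hK₀ (show 0 < r ^ 2 - x ^ 2 by nlinarith [hx.1, hx.2])]
  have hposr : ∀ y ∈ Set.Ioc 0 r, 0 < landauDeriv K y := by
    intro y hy
    have := hmono ⟨le_rfl, hr0.le⟩ ⟨hy.1.le, hy.2⟩ hy.1
    rwa [landauDeriv_zero] at this
  -- A point where the derivative is negative: `K z < K < K + 1 = artanh z`. It closes the bracket
  -- for the root `x`.
  set z := Real.tanh (K + 1) with hz
  have hz0 : 0 < z := by
    rw [hz, Real.tanh_eq_sinh_div_cosh]
    exact div_pos (Real.sinh_pos_iff.2 (by linarith)) (Real.cosh_pos _)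
  have hz1 : z < 1 := Real.tanh_lt_one _
  have hzneg : landauDeriv K z < 0 := by
    rw [landauDeriv, hz, Real.artanh_tanh, ← hz]
    nlinarith
  have hrz : r < z := by
    by_contra! hle
    exact absurd (hposr z ⟨hz0, hle⟩) (not_lt.2 hzneg.le)
  obtain ⟨x, hx, hx0⟩ : (0 : ℝ) ∈ landauDeriv K '' Set.Ioo r z :=
    intermediate_value_Ioo' hrz.le ((continuousOn_landauDeriv K).mono
      fun y hy => ⟨by linarith [hy.1], by linarith [hy.2]⟩) ⟨hzneg, hposr r ⟨hr0, le_rfl⟩⟩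
  have hx1 : x < 1 := hx.2.trans hz1
  have hxp : 0 < x := hr0.trans hx.1
  have hpos : ∀ y ∈ Set.Ioo 0 x, 0 < landauDeriv K y := by
    intro y hy
    rcases le_or_gt y r with h | h
    · exact hposr y ⟨hy.1, h⟩
    · have := hanti ⟨h.le, hy.2.trans hx1⟩ ⟨hx.1.le, hx1⟩ hy.2
      rwa [hx0] at this
  have hneg : ∀ y ∈ Set.Ioo x 1, landauDeriv K y < 0 := by
    intro y hy
    have := hanti ⟨hx.1.le, hx1⟩ ⟨(hx.1.trans hy.1).le, hy.2⟩ hy.1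
    rwa [hx0] at this
  have hup : StrictMonoOn (landau K) (Set.Icc 0 x) := by
    refine strictMonoOn_of_deriv_pos (convex_Icc 0 x) (continuous_landau K).continuousOn
      fun y hy => ?_
    rw [interior_Icc] at hy
    rw [(hasDerivAt_landau K ⟨by linarith [hy.1], by linarith [hy.2]⟩).deriv]
    exact hpos y hy
  have hdown : StrictAntiOn (landau K) (Set.Icc x 1) := by
    refine strictAntiOn_of_deriv_neg (convex_Icc x 1) (continuous_landau K).continuousOn
      fun y hy => ?_
    rw [interior_Icc] at hy
    rw [(hasDerivAt_landau K ⟨by linarith [hy.1], by linarith [hy.2]⟩).deriv]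
    exact hneg y hy
  have hlt : ∀ y ∈ Set.Icc (0 : ℝ) 1, y ≠ x → landau K y < landau K x := by
    intro y hy hne
    rcases lt_or_gt_of_ne hne with h | h
    · exact hup ⟨hy.1, h.le⟩ ⟨hxp.le, le_rfl⟩ h
    · exact hdown ⟨le_rfl, hx1.le⟩ ⟨h.le, hy.2⟩ h
  have hroot : ∀ y ∈ Set.Ico (0 : ℝ) 1, landauDeriv K y = 0 → y = 0 ∨ y = x := by
    intro y hy h
    by_contra! hne
    have hy0 : 0 < y := lt_of_le_of_ne hy.1 (Ne.symm hne.1)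
    rcases lt_or_gt_of_ne hne.2 with h' | h'
    · exact (hpos y ⟨hy0, h'⟩).ne' h
    · exact (hneg y ⟨h', hy.2⟩).ne h
  refine ⟨x, r, hr0.le, hx.1, hx1, strictConcaveOn_landau hr0.le hKr.le hK₀, fun y => ?_, ?_,
    fun y hy => ?_⟩
  · rw [eq_tanh_iff]
    constructor
    · rintro ⟨hy, h⟩
      rcases le_or_gt 0 y with hy0 | hy0
      · rcases hroot y ⟨hy0, hy.2⟩ h with h | h <;> simp [h]
      · have := hroot (-y) ⟨by linarith, by linarith [hy.1]⟩
          (by rw [landauDeriv_neg K hy, h, neg_zero])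
        rcases this with h | h
        · exact Or.inl (by linarith)
        · exact Or.inr (Or.inr (by linarith))
    · have hx' : x ∈ Set.Ioo (-1 : ℝ) 1 := ⟨by linarith, hx1⟩
      rintro (rfl | rfl | rfl)
      · exact ⟨by norm_num, landauDeriv_zero K⟩
      · exact ⟨hx', hx0⟩
      · exact ⟨⟨by linarith, by linarith⟩, by rw [landauDeriv_neg K hx', hx0, neg_zero]⟩
  · have := hlt 0 ⟨le_rfl, zero_le_one⟩ hxp.ne
    rwa [landau_zero] at this
  · have hy' : |y| ∈ Set.Icc (0 : ℝ) 1 := ⟨abs_nonneg y, abs_le.2 hy⟩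
    rw [← landau_abs K y]
    rcases eq_or_ne |y| x with h | h
    · exact ⟨by rw [h], fun _ => (abs_eq hxp.le).1 h⟩
    · exact ⟨(hlt _ hy' h).le, fun h' => absurd h' (hlt _ hy' h).ne⟩

/-! ### The pressure functional of two equal populations -/

/-- Decouples the populations up to a square: `2 μ₁ μ₂ = (μ₁ + μ₂)² - μ₁² - μ₂²`. -/
lemma functional_eq (β J₁₁ J₁₂ : ℝ) (h μ : Fin 2 → ℝ) :
    functional β half (coupling J₁₁ J₁₂) h μ =
      (landau (β * (J₁₁ - J₁₂) / 2) (μ 0) + landau (β * (J₁₁ - J₁₂) / 2) (μ 1)) / 2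
        + β * J₁₂ / 8 * (μ 0 + μ 1) ^ 2 + β / 2 * (μ ⬝ᵥ h) := by
  simp [functional, energy, half, coupling, landau, dotProduct, Fin.sum_univ_two]
  ring

lemma functional_eq_add (β J₁₁ J₁₂ : ℝ) (h μ : Fin 2 → ℝ) :
    functional β half (coupling J₁₁ J₁₂) h μ =
      functional β half (coupling J₁₁ J₁₂) 0 μ + β / 2 * (μ ⬝ᵥ h) := by
  rw [functional_eq, functional_eq, dotProduct_zero]; ring

lemma mem_square_iff {μ : Fin 2 → ℝ} :
    μ ∈ Set.Icc (-1 : Fin 2 → ℝ) 1 ↔ μ 0 ∈ Set.Icc (-1 : ℝ) 1 ∧ μ 1 ∈ Set.Icc (-1 : ℝ) 1 := by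
  simp [Set.mem_Icc, Pi.le_def, Fin.forall_fin_two]
  tauto

lemma abs_dotProduct_lt {δ : ℝ} {μ h : Fin 2 → ℝ} (hμ : μ ∈ Set.Icc (-1 : Fin 2 → ℝ) 1)
    (h0 : |h 0| < δ) (h1 : |h 1| < δ) : |μ ⬝ᵥ h| < 2 * δ := by
  obtain ⟨m0, m1⟩ := mem_square_iff.1 hμ
  have a0 : |μ 0| ≤ 1 := abs_le.2 m0
  have a1 : |μ 1| ≤ 1 := abs_le.2 m1
  have e : μ ⬝ᵥ h = μ 0 * h 0 + μ 1 * h 1 := by simp [dotProduct, Fin.sum_univ_two]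
  rw [e]
  refine (abs_add_le _ _).trans_lt ?_
  rw [abs_mul, abs_mul]
  nlinarith [mul_le_mul_of_nonneg_right a0 (abs_nonneg (h 0)),
    mul_le_mul_of_nonneg_right a1 (abs_nonneg (h 1))]

lemma states_nonempty (β : ℝ) (α : Fin 2 → ℝ) (J : Matrix (Fin 2) (Fin 2) ℝ) (h : Fin 2 → ℝ) :
    (states β α J h).Nonempty := by
  obtain ⟨m, hm, hmax⟩ := (isCompact_Icc (a := (-1 : Fin 2 → ℝ)) (b := 1)).exists_isMaxOn
    ⟨0, mem_square_iff.2 ⟨by simp, by simp⟩⟩ (continuous_functional β α J h).continuousOn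
  exact ⟨m, hm, fun ν hν => hmax hν⟩

/-- The states depend upper semicontinuously on the field at zero field. -/
lemma exists_dist_zero_field_state_lt {β : ℝ} (hβ : 0 < β) (J₁₁ J₁₂ : ℝ) {ε : ℝ} (hε : 0 < ε) :
    ∃ δ > 0, ∀ h : Fin 2 → ℝ, |h 0| < δ → |h 1| < δ →
      ∀ m ∈ states β half (coupling J₁₁ J₁₂) h,
        ∃ s ∈ states β half (coupling J₁₁ J₁₂) 0, dist m s < ε := by
  set C : Set (Fin 2 → ℝ) := Set.Icc (-1) 1 ∩
    ⋂ s ∈ states β half (coupling J₁₁ J₁₂) 0, {μ | ε ≤ dist μ s} with hC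
  have hmem : ∀ m ∈ Set.Icc (-1 : Fin 2 → ℝ) 1,
      (¬ ∃ s ∈ states β half (coupling J₁₁ J₁₂) 0, dist m s < ε) → m ∈ C := by
    intro m hm hs
    push Not at hs
    exact ⟨hm, Set.mem_iInter₂.2 hs⟩
  have hcomp : IsCompact C := isCompact_Icc.inter_right <|
    isClosed_biInter fun s _ => isClosed_le continuous_const (continuous_id.dist continuous_const)
  rcases C.eq_empty_or_nonempty with h0 | h0
  · refine ⟨1, one_pos, fun h _ _ m hm => ?_⟩
    by_contra hs
    have := hmem m hm.1 hs
    rw [h0] at this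
    exact this
  · obtain ⟨c, hc, hmax⟩ := hcomp.exists_isMaxOn h0
      (continuous_functional β half (coupling J₁₁ J₁₂) 0).continuousOn
    have hcs : c ∉ states β half (coupling J₁₁ J₁₂) 0 := fun hcs => by
      have : ε ≤ dist c c := Set.mem_iInter₂.1 hc.2 c hcs
      rw [dist_self] at this
      linarith
    obtain ⟨ν, hν, hlt⟩ : ∃ ν ∈ Set.Icc (-1 : Fin 2 → ℝ) 1,
        functional β half (coupling J₁₁ J₁₂) 0 c < functional β half (coupling J₁₁ J₁₂) 0 ν := by
      by_contra! hle
      exact hcs ⟨hc.1, hle⟩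
    -- With `D` the gap between `ν` and the best point of `C`, this is `δ = D/(2β)`. The field term
    -- is below `βδ = D/2` in absolute value at each of the two points compared, so it cannot close
    -- the gap.
    refine ⟨(functional β half (coupling J₁₁ J₁₂) 0 ν
      - functional β half (coupling J₁₁ J₁₂) 0 c) / (2 * β), div_pos (by linarith) (by linarith),
      fun h h1 h2 m hm => ?_⟩
    by_contra hs
    have hmC : functional β half (coupling J₁₁ J₁₂) 0 m ≤ functional β half (coupling J₁₁ J₁₂) 0 c :=
      hmax (hmem m hm.1 hs)
    have hge := hm.2 ν hν
    rw [functional_eq_add β J₁₁ J₁₂ h ν, functional_eq_add β J₁₁ J₁₂ h m] at hge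
    have d1 := (abs_lt.1 (abs_dotProduct_lt hν h1 h2)).1
    have d2 := (abs_lt.1 (abs_dotProduct_lt hm.1 h1 h2)).2
    set D := functional β half (coupling J₁₁ J₁₂) 0 ν
      - functional β half (coupling J₁₁ J₁₂) 0 c with hD
    have e : β / 2 * (2 * (D / (2 * β))) = D / 2 := by field_simp
    have f1 := mul_lt_mul_of_pos_left d1 (half_pos hβ)
    have f2 := mul_lt_mul_of_pos_left d2 (half_pos hβ)
    rw [mul_neg, e] at f1
    rw [e] at f2
    linarith

/-- Two states coincide if the one-population functional is strictly concave between their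
coordinates. -/
lemma eq_of_mem_states {β J₁₁ J₁₂ : ℝ} (hβ : 0 < β) (hJ₁₂ : J₁₂ < 0) {h μ ν : Fin 2 → ℝ}
    (hμ : μ ∈ states β half (coupling J₁₁ J₁₂) h) (hν : ν ∈ states β half (coupling J₁₁ J₁₂) h)
    (hG : ∀ l, μ l ≠ ν l → (landau (β * (J₁₁ - J₁₂) / 2) (μ l)
      + landau (β * (J₁₁ - J₁₂) / 2) (ν l)) / 2 <
        landau (β * (J₁₁ - J₁₂) / 2) ((μ l + ν l) / 2)) : μ = ν := by
  by_contra hne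
  set K := β * (J₁₁ - J₁₂) / 2 with hK
  have hG' : ∀ l, (landau K (μ l) + landau K (ν l)) / 2 ≤ landau K ((μ l + ν l) / 2) := by
    intro l
    rcases eq_or_ne (μ l) (ν l) with h | h
    · rw [h]; apply le_of_eq; ring_nf
    · exact (hG l h).le
  have hsum : (landau K (μ 0) + landau K (ν 0)) / 2 + (landau K (μ 1) + landau K (ν 1)) / 2 <
      landau K ((μ 0 + ν 0) / 2) + landau K ((μ 1 + ν 1) / 2) := by
    obtain ⟨l, hl⟩ := Function.ne_iff.1 hne
    have h0 := hG' 0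
    have h1 := hG' 1
    have hl' := hG l hl
    fin_cases l
    · exact add_lt_add_of_lt_of_le hl' h1
    · exact add_lt_add_of_le_of_lt h0 hl'
  obtain ⟨μ0, μ1⟩ := mem_square_iff.1 hμ.1
  obtain ⟨ν0, ν1⟩ := mem_square_iff.1 hν.1
  -- The midpoint would beat both maximum points: the `landau` part gains strictly, the square term
  -- does not lose as `J₁₂ < 0`, and the field term is linear.
  have hmid : (fun l => (μ l + ν l) / 2) ∈ Set.Icc (-1 : Fin 2 → ℝ) 1 :=
    mem_square_iff.2 ⟨⟨by linarith [μ0.1, ν0.1], by linarith [μ0.2, ν0.2]⟩,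
      ⟨by linarith [μ1.1, ν1.1], by linarith [μ1.2, ν1.2]⟩⟩
  have e1 := hμ.2 _ hmid
  have e2 := hν.2 _ hmid
  simp only [functional_eq, ← hK, dotProduct, Fin.sum_univ_two] at e1 e2
  have hq : 0 ≤ -(β * J₁₂ / 8) * ((μ 0 + μ 1) - (ν 0 + ν 1)) ^ 2 :=
    mul_nonneg (by nlinarith) (sq_nonneg _)
  nlinarith

lemma functional_swap (β J₁₁ J₁₂ : ℝ) (h μ : Fin 2 → ℝ) :
    functional β half (coupling J₁₁ J₁₂) h (swap μ) =
      functional β half (coupling J₁₁ J₁₂) h μ - β / 2 * ((h 0 - h 1) * (μ 0 - μ 1)) := by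
  simp only [functional_eq, swap, dotProduct, Fin.sum_univ_two, Matrix.cons_val_zero,
    Matrix.cons_val_one]
  ring

lemma functional_swap_const (β J₁₁ J₁₂ c : ℝ) (μ : Fin 2 → ℝ) :
    functional β half (coupling J₁₁ J₁₂) ![c, c] (swap μ) =
      functional β half (coupling J₁₁ J₁₂) ![c, c] μ := by
  rw [functional_swap]; simp

lemma swap_mem_square {μ : Fin 2 → ℝ} (hμ : μ ∈ Set.Icc (-1 : Fin 2 → ℝ) 1) :
    swap μ ∈ Set.Icc (-1 : Fin 2 → ℝ) 1 := by
  rw [mem_square_iff] at hμ ⊢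
  exact ⟨hμ.2, hμ.1⟩

lemma swap_swap (μ : Fin 2 → ℝ) : swap (swap μ) = μ := by
  funext l; fin_cases l <;> rfl

lemma swap_mem_states {β J₁₁ J₁₂ c : ℝ} {μ : Fin 2 → ℝ}
    (hμ : μ ∈ states β half (coupling J₁₁ J₁₂) ![c, c]) :
    swap μ ∈ states β half (coupling J₁₁ J₁₂) ![c, c] :=
  ⟨swap_mem_square hμ.1, fun ν hν => by rw [functional_swap_const]; exact hμ.2 ν hν⟩

lemma swap_mem_states_iff {β J₁₁ J₁₂ c : ℝ} {μ : Fin 2 → ℝ} :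
    swap μ ∈ states β half (coupling J₁₁ J₁₂) ![c, c] ↔
      μ ∈ states β half (coupling J₁₁ J₁₂) ![c, c] :=
  ⟨fun h => by simpa only [swap_swap] using swap_mem_states h, swap_mem_states⟩

lemma dist_swap_lt {ε : ℝ} (hε : 0 < ε) {μ ν : Fin 2 → ℝ} (h : dist μ ν < ε) :
    dist (swap μ) (swap ν) < ε := by
  rw [dist_pi_lt_iff hε, Fin.forall_fin_two] at h ⊢
  exact ⟨h.2, h.1⟩

/-- In the coordinates `v₀ ± v₁` the matrix is diagonal with entries `J₁₁ ± J₁₂`; a larger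
eigenvalue would force both coordinates to vanish. -/
lemma isGreatest_eigenvalue {J₁₁ J₁₂ lamM : ℝ} (hJ₁₂ : J₁₂ < 0)
    (hlamM : IsGreatest
      {x : ℝ | Module.End.HasEigenvalue (Matrix.toLin' (coupling J₁₁ J₁₂)) x} lamM) :
    lamM = J₁₁ - J₁₂ := by
  apply le_antisymm
  · obtain ⟨v, hv⟩ := hlamM.1.exists_hasEigenvector
    have h := hv.apply_eq_smul
    rw [Matrix.toLin'_apply] at h
    have h0 := congrFun h 0
    have h1 := congrFun h 1
    simp [coupling, Matrix.mulVec, dotProduct, Fin.sum_univ_two] at h0 h1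
    by_contra! hlt
    have a : (lamM - J₁₁ - J₁₂) * (v 0 + v 1) = 0 := by linarith
    have b : (lamM - J₁₁ + J₁₂) * (v 0 - v 1) = 0 := by linarith
    have a' : v 0 + v 1 = 0 := (mul_eq_zero.1 a).resolve_left (by linarith)
    have b' : v 0 - v 1 = 0 := (mul_eq_zero.1 b).resolve_left (by linarith)
    refine hv.2 ?_
    funext l
    fin_cases l
    · change v 0 = 0; linarith
    · change v 1 = 0; linarith
  · refine hlamM.2 (Module.End.hasEigenvalue_of_hasEigenvector (x := ![1, -1]) ⟨?_, ?_⟩)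
    · rw [Module.End.mem_eigenspace_iff, Matrix.toLin'_apply]
      funext l
      fin_cases l <;> simp [coupling, Matrix.mulVec, dotProduct, Fin.sum_univ_two] <;> ring
    · intro h
      simpa using congrFun h 0

/-! ### Subcritical coupling -/

lemma functional_zero_zero (β J₁₁ J₁₂ : ℝ) (h : Fin 2 → ℝ) :
    functional β half (coupling J₁₁ J₁₂) h 0 = 0 := by
  simp [functional_eq]

lemma functional_zero_neg {β J₁₁ J₁₂ : ℝ} (hβ : 0 < β) (hJ₁₂ : J₁₂ < 0)
    (hK₀ : 0 < β * (J₁₁ - J₁₂) / 2) (hK : β * (J₁₁ - J₁₂) / 2 ≤ 1) {μ : Fin 2 → ℝ}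
    (hμ : μ ∈ Set.Icc (-1 : Fin 2 → ℝ) 1) (hne : μ ≠ 0) :
    functional β half (coupling J₁₁ J₁₂) 0 μ < 0 := by
  rw [functional_eq, dotProduct_zero]
  obtain ⟨h0, h1⟩ := mem_square_iff.1 hμ
  have hle : ∀ y ∈ Set.Icc (-1 : ℝ) 1, landau (β * (J₁₁ - J₁₂) / 2) y ≤ 0 := by
    intro y hy
    rcases eq_or_ne y 0 with rfl | h
    · simp
    · exact (landau_neg_of_le_one hK₀ hK hy h).le
  have hq : β * J₁₂ / 8 * (μ 0 + μ 1) ^ 2 ≤ 0 :=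
    mul_nonpos_of_nonpos_of_nonneg (by nlinarith) (sq_nonneg _)
  rcases eq_or_ne (μ 0) 0 with h | h
  · have h' : μ 1 ≠ 0 := fun h' => hne (by funext l; fin_cases l; exacts [h, h'])
    linarith [hle _ h0, landau_neg_of_le_one hK₀ hK h1 h']
  · linarith [hle _ h1, landau_neg_of_le_one hK₀ hK h0 h]

lemma states_zero_of_le_one {β J₁₁ J₁₂ : ℝ} (hβ : 0 < β) (hJ₁₂ : J₁₂ < 0)
    (hK₀ : 0 < β * (J₁₁ - J₁₂) / 2) (hK : β * (J₁₁ - J₁₂) / 2 ≤ 1) :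
    states β half (coupling J₁₁ J₁₂) 0 = {0} := by
  have h0 : (0 : Fin 2 → ℝ) ∈ Set.Icc (-1 : Fin 2 → ℝ) 1 :=
    mem_square_iff.2 ⟨by simp, by simp⟩
  ext μ
  rw [Set.mem_singleton_iff]
  constructor
  · intro hμ
    by_contra hne
    have := hμ.2 0 h0
    rw [functional_zero_zero] at this
    linarith [functional_zero_neg hβ hJ₁₂ hK₀ hK hμ.1 hne]
  · rintro rfl
    refine ⟨h0, fun ν hν => ?_⟩
    rw [functional_zero_zero]
    rcases eq_or_ne ν 0 with rfl | h
    · rw [functional_zero_zero]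
    · exact (functional_zero_neg hβ hJ₁₂ hK₀ hK hν h).le

lemma eq_of_mem_states_of_le_one {β J₁₁ J₁₂ : ℝ} (hβ : 0 < β) (hJ₁₂ : J₁₂ < 0)
    (hK₀ : 0 < β * (J₁₁ - J₁₂) / 2) (hK : β * (J₁₁ - J₁₂) / 2 ≤ 1) {h μ ν : Fin 2 → ℝ}
    (hμ : μ ∈ states β half (coupling J₁₁ J₁₂) h)
    (hν : ν ∈ states β half (coupling J₁₁ J₁₂) h) : μ = ν := by
  refine eq_of_mem_states hβ hJ₁₂ hμ hν fun l hl => ?_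
  have := (strictConcaveOn_landau_of_le_one hK₀ hK).2 ⟨hμ.1.1 l, hμ.1.2 l⟩
    ⟨hν.1.1 l, hν.1.2 l⟩ hl (by norm_num : (0 : ℝ) < 1 / 2) (by norm_num : (0 : ℝ) < 1 / 2)
    (by norm_num)
  simp only [smul_eq_mul] at this
  rw [show (μ l + ν l) / 2 = 1 / 2 * μ l + 1 / 2 * ν l by ring]
  linarith

/-- The origin is not a state in a non-zero field. -/
lemma zero_notMem_states {β J₁₁ J₁₂ : ℝ} (hβ : 0 < β) (hJ₁₂ : J₁₂ < 0)
    (hK₀ : 0 < β * (J₁₁ - J₁₂) / 2) {h : Fin 2 → ℝ} (h0 : |h 0| < 1) (h1 : |h 1| < 1)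
    (hne : h 0 ≠ h 1) : (0 : Fin 2 → ℝ) ∉ states β half (coupling J₁₁ J₁₂) h := by
  intro hs
  have hd : 0 < 2 - β * J₁₂ + β := by nlinarith
  -- The trial point is `r h`. Its value is at least `r |h|² (2β - r (2 - βJ₁₂))/4`, and this `r`
  -- turns the bracket into `β + rβ > 0`. The extra `β` in the denominator ensures `r < 1`.
  obtain ⟨r, hr⟩ : ∃ r, r = β / (2 - β * J₁₂ + β) := ⟨_, rfl⟩
  have hr0 : 0 < r := hr ▸ div_pos hβ hd
  have hrd : r * (2 - β * J₁₂ + β) = β := by rw [hr]; field_simp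
  have hr1 : r < 1 := by rw [hr, div_lt_one hd]; nlinarith
  have hy : ∀ y : ℝ, |y| < 1 → r * y ∈ Set.Ioo (-1 : ℝ) 1 := by
    intro y hy
    rw [Set.mem_Ioo, ← abs_lt, abs_mul, abs_of_pos hr0]
    nlinarith [abs_nonneg y]
  have hl : ∀ y : ℝ, |y| < 1 → -(r * y) ^ 2 ≤ landau (β * (J₁₁ - J₁₂) / 2) (r * y) := by
    intro y hy'
    have := entropy_le_sq (hy y hy')
    rw [landau]
    nlinarith [mul_nonneg hK₀.le (sq_nonneg (r * y))]
  have hle := hs.2 (fun l => r * h l) (mem_square_iff.2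
    ⟨Set.Ioo_subset_Icc_self (hy _ h0), Set.Ioo_subset_Icc_self (hy _ h1)⟩)
  rw [functional_zero_zero, functional_eq] at hle
  simp only [dotProduct, Fin.sum_univ_two] at hle
  have l0 := hl _ h0
  have l1 := hl _ h1
  have hpos : 0 < h 0 ^ 2 + h 1 ^ 2 := by
    nlinarith [pow_pos (abs_pos.2 (sub_ne_zero.2 hne)) 2, sq_abs (h 0 - h 1),
      sq_nonneg (h 0 + h 1)]
  have hsq : (r * h 0 + r * h 1) ^ 2 ≤ 2 * r ^ 2 * (h 0 ^ 2 + h 1 ^ 2) := by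
    nlinarith [mul_nonneg (sq_nonneg r) (sq_nonneg (h 0 - h 1))]
  have hq := mul_le_mul_of_nonneg_left hsq (show 0 ≤ -(β * J₁₂ / 8) by nlinarith)
  have key : 0 < (h 0 ^ 2 + h 1 ^ 2) * r * (β + r * β) := by positivity
  have e : (h 0 ^ 2 + h 1 ^ 2) * r * (r * (2 - β * J₁₂ + β)) = (h 0 ^ 2 + h 1 ^ 2) * r * β := by
    rw [hrd]
  nlinarith

/-- Since `f_h(m) ≥ f_h(0) = 0 > f_0(m)`, the field term must be positive. -/
lemma dotProduct_pos_of_le_one {β J₁₁ J₁₂ : ℝ} (hβ : 0 < β) (hJ₁₂ : J₁₂ < 0)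
    (hK₀ : 0 < β * (J₁₁ - J₁₂) / 2) (hK : β * (J₁₁ - J₁₂) / 2 ≤ 1) {h m : Fin 2 → ℝ}
    (h0 : |h 0| < 1) (h1 : |h 1| < 1) (hne : h 0 ≠ h 1)
    (hm : m ∈ states β half (coupling J₁₁ J₁₂) h) : 0 < m ⬝ᵥ h := by
  have hm0 : m ≠ 0 := fun h' => zero_notMem_states hβ hJ₁₂ hK₀ h0 h1 hne (h' ▸ hm)
  have hlt := functional_zero_neg hβ hJ₁₂ hK₀ hK hm.1 hm0
  have hge := hm.2 0 (mem_square_iff.2 ⟨by simp, by simp⟩)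
  rw [functional_zero_zero, functional_eq_add] at hge
  exact pos_of_mul_pos_right (a := β / 2) (by linarith) (by linarith)

/-! ### Supercritical coupling -/

lemma functional_antidiagonal (β J₁₁ J₁₂ x : ℝ) :
    functional β half (coupling J₁₁ J₁₂) 0 ![x, -x] = landau (β * (J₁₁ - J₁₂) / 2) x := by
  rw [functional_eq]
  simp [landau_neg]

/-- The two `landau` terms and the square are bounded separately; all bounds are attained together
only on the antidiagonal with `μ₁ = ±x`. -/
lemma states_zero_of_max {β J₁₁ J₁₂ x : ℝ} (hβ : 0 < β) (hJ₁₂ : J₁₂ < 0) (hx₀ : 0 < x)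
    (hx₁ : x < 1)
    (hmax : ∀ y ∈ Set.Icc (-1 : ℝ) 1,
      landau (β * (J₁₁ - J₁₂) / 2) y ≤ landau (β * (J₁₁ - J₁₂) / 2) x ∧
        (landau (β * (J₁₁ - J₁₂) / 2) y = landau (β * (J₁₁ - J₁₂) / 2) x → y = x ∨ y = -x)) :
    states β half (coupling J₁₁ J₁₂) 0 = {![x, -x], ![-x, x]} := by
  have hq : β * J₁₂ / 8 < 0 := by nlinarith
  have hsq : ∀ y : ℝ, (y = x ∨ y = -x) → y ∈ Set.Icc (-1 : ℝ) 1 := by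
    rintro y (rfl | rfl) <;> constructor <;> linarith
  have hle : ∀ ν ∈ Set.Icc (-1 : Fin 2 → ℝ) 1, functional β half (coupling J₁₁ J₁₂) 0 ν ≤
      landau (β * (J₁₁ - J₁₂) / 2) x := by
    intro ν hν
    obtain ⟨h0, h1⟩ := mem_square_iff.1 hν
    rw [functional_eq, dotProduct_zero]
    nlinarith [(hmax _ h0).1, (hmax _ h1).1, sq_nonneg (ν 0 + ν 1)]
  have hx : ![x, -x] ∈ Set.Icc (-1 : Fin 2 → ℝ) 1 :=
    mem_square_iff.2 ⟨hsq _ (Or.inl rfl), hsq _ (Or.inr rfl)⟩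
  have hx' : ![-x, x] ∈ Set.Icc (-1 : Fin 2 → ℝ) 1 :=
    mem_square_iff.2 ⟨hsq _ (Or.inr rfl), hsq _ (Or.inl rfl)⟩
  ext μ
  rw [Set.mem_insert_iff, Set.mem_singleton_iff]
  constructor
  · intro hμ
    obtain ⟨h0, h1⟩ := mem_square_iff.1 hμ.1
    have hge := hμ.2 _ hx
    rw [functional_antidiagonal, functional_eq, dotProduct_zero] at hge
    have g0 := (hmax _ h0).1
    have g1 := (hmax _ h1).1
    have hn : β * J₁₂ / 8 * (μ 0 + μ 1) ^ 2 ≤ 0 :=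
      mul_nonpos_of_nonpos_of_nonneg hq.le (sq_nonneg _)
    have e0 := (hmax _ h0).2 (by linarith)
    have hs : μ 0 + μ 1 = 0 := by
      have : β * J₁₂ / 8 * (μ 0 + μ 1) ^ 2 = 0 := by linarith
      exact pow_eq_zero_iff two_ne_zero |>.1 ((mul_eq_zero.1 this).resolve_left hq.ne)
    rcases e0 with e | e
    · left; funext l; fin_cases l
      · exact e
      · change μ 1 = -x; linarith
    · right; funext l; fin_cases l
      · exact e
      · change μ 1 = x; linarith
  · rintro (rfl | rfl)
    · exact ⟨hx, fun ν hν => by rw [functional_antidiagonal]; exact hle ν hν⟩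
    · refine ⟨hx', fun ν hν => ?_⟩
      have := functional_antidiagonal β J₁₁ J₁₂ (-x)
      rw [neg_neg, landau_neg] at this
      rw [this]
      exact hle ν hν

/-- In a small field every state lies near one of the zero-field states. -/
lemma exists_states_separated {β J₁₁ J₁₂ x r ε : ℝ} (hβ : 0 < β) (hr : r < x)
    (hstates : states β half (coupling J₁₁ J₁₂) 0 = {![x, -x], ![-x, x]}) (hε : 0 < ε) :
    ∃ δ > 0, ∀ h : Fin 2 → ℝ, |h 0| < δ → |h 1| < δ →
      ∀ m ∈ states β half (coupling J₁₁ J₁₂) h,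
        (r < m 0 ∧ m 1 < -r ∧ dist m ![x, -x] < ε) ∨
          (m 0 < -r ∧ r < m 1 ∧ dist m ![-x, x] < ε) := by
  -- Closeness `x - r` puts each coordinate where its modulus exceeds `r`, hence into the range of
  -- strict concavity.
  have hε' : 0 < min ε (x - r) := lt_min hε (by linarith)
  obtain ⟨δ, hδ, H⟩ := exists_dist_zero_field_state_lt hβ J₁₁ J₁₂ hε'
  refine ⟨δ, hδ, fun h h0 h1 m hm => ?_⟩
  obtain ⟨s, hs, hd⟩ := H h h0 h1 m hm
  have hd1 := hd.trans_le (min_le_left _ _)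
  have hd2 := hd.trans_le (min_le_right _ _)
  rw [dist_pi_lt_iff (by linarith), Fin.forall_fin_two, Real.dist_eq, Real.dist_eq,
    abs_lt, abs_lt] at hd2
  obtain ⟨⟨a, b⟩, c, d⟩ := hd2
  rw [hstates] at hs
  rcases hs with rfl | rfl
  · simp at a b c d
    exact Or.inl ⟨by linarith, by linarith, hd1⟩
  · simp at a b c d
    exact Or.inr ⟨by linarith, by linarith, hd1⟩

/-- In each of the two opposite corners of the square there is at most one state. -/
lemma eq_of_mem_states_of_separated {β J₁₁ J₁₂ r : ℝ} (hβ : 0 < β) (hJ₁₂ : J₁₂ < 0)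
    (hconc : StrictConcaveOn ℝ (Set.Icc r 1) (landau (β * (J₁₁ - J₁₂) / 2)))
    {h μ ν : Fin 2 → ℝ} (hμ : μ ∈ states β half (coupling J₁₁ J₁₂) h)
    (hν : ν ∈ states β half (coupling J₁₁ J₁₂) h)
    (hs : (r < μ 0 ∧ μ 1 < -r ∧ r < ν 0 ∧ ν 1 < -r) ∨
      (μ 0 < -r ∧ r < μ 1 ∧ ν 0 < -r ∧ r < ν 1)) : μ = ν := by
  have hpos : ∀ y ∈ Set.Icc r 1, ∀ z ∈ Set.Icc r 1, y ≠ z →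
      (landau (β * (J₁₁ - J₁₂) / 2) y + landau (β * (J₁₁ - J₁₂) / 2) z) / 2 <
        landau (β * (J₁₁ - J₁₂) / 2) ((y + z) / 2) := by
    intro y hy z hz hne
    have := hconc.2 hy hz hne (by norm_num : (0 : ℝ) < 1 / 2) (by norm_num : (0 : ℝ) < 1 / 2)
      (by norm_num)
    simp only [smul_eq_mul] at this
    rw [show (y + z) / 2 = 1 / 2 * y + 1 / 2 * z by ring]
    linarith
  have hneg : ∀ y z, -y ∈ Set.Icc r 1 → -z ∈ Set.Icc r 1 → y ≠ z →
      (landau (β * (J₁₁ - J₁₂) / 2) y + landau (β * (J₁₁ - J₁₂) / 2) z) / 2 <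
        landau (β * (J₁₁ - J₁₂) / 2) ((y + z) / 2) := by
    intro y z hy hz hne
    have := hpos _ hy _ hz (fun h => hne (neg_injective h))
    rwa [landau_neg, landau_neg, show (-y + -z) / 2 = -((y + z) / 2) by ring, landau_neg] at this
  obtain ⟨μ0, μ1⟩ := mem_square_iff.1 hμ.1
  obtain ⟨ν0, ν1⟩ := mem_square_iff.1 hν.1
  refine eq_of_mem_states hβ hJ₁₂ hμ hν (Fin.forall_fin_two.2 ?_)
  rcases hs with ⟨a, b, c, d⟩ | ⟨a, b, c, d⟩
  · exact ⟨hpos _ ⟨a.le, μ0.2⟩ _ ⟨c.le, ν0.2⟩,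
      hneg _ _ ⟨by linarith, by linarith [μ1.1]⟩ ⟨by linarith, by linarith [ν1.1]⟩⟩
  · exact ⟨hneg _ _ ⟨by linarith, by linarith [μ0.1]⟩ ⟨by linarith, by linarith [ν0.1]⟩,
      hpos _ ⟨b.le, μ1.2⟩ _ ⟨d.le, ν1.2⟩⟩

/-- Reflecting a state cannot increase the functional, and only the field term notices the
reflection. -/
lemma mul_sub_nonneg_of_mem_states {β J₁₁ J₁₂ : ℝ} (hβ : 0 < β) {h m : Fin 2 → ℝ}
    (hm : m ∈ states β half (coupling J₁₁ J₁₂) h) : 0 ≤ (h 0 - h 1) * (m 0 - m 1) := by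
  have := hm.2 _ (swap_mem_square hm.1)
  rw [functional_swap] at this
  exact nonneg_of_mul_nonneg_right (by linarith) (half_pos hβ)

/-- Adding `f_h(s) ≤ f_h(m)` and `f_0(m) ≤ f_0(s)` leaves `⟨s, h⟩ ≤ ⟨m, h⟩`. -/
lemma dotProduct_pos_of_zero_field_state {β J₁₁ J₁₂ : ℝ} (hβ : 0 < β) {h m s : Fin 2 → ℝ}
    (hm : m ∈ states β half (coupling J₁₁ J₁₂) h) (hs : s ∈ states β half (coupling J₁₁ J₁₂) 0)
    (hsh : 0 < s ⬝ᵥ h) : 0 < m ⬝ᵥ h := by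
  have h1 := hm.2 s hs.1
  have h2 := hs.2 m hm.1
  rw [functional_eq_add β J₁₁ J₁₂ h s, functional_eq_add β J₁₁ J₁₂ h m] at h1
  have h3 := mul_pos (half_pos hβ) hsh
  exact pos_of_mul_pos_right (a := β / 2) (by linarith) (by linarith)

end Bipartite

end

/-! ### The phase transition and the response to small fields -/

open Bipartite in
theorem proposition3 (J₁₁ J₁₂ β lamM t : ℝ) (hJ₁₁ : 0 < J₁₁) (hJ₁₂ : J₁₂ < 0) (hβ : 0 < β)
    (hlamM : IsGreatest
      {x : ℝ | Module.End.HasEigenvalue (Matrix.toLin' (coupling J₁₁ J₁₂)) x} lamM)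
    (ht : t = 2 * (β * lamM)⁻¹) :
    -- zero field, `t ≥ 1`
    (1 ≤ t →
      Tendsto (fun k : ℕ => pressure β (coupling J₁₁ J₁₂) 0 (fun _ => k)) atTop
          (𝓝 (Real.log 2 + functional β half (coupling J₁₁ J₁₂) 0 0)) ∧
        Real.log 2 + functional β half (coupling J₁₁ J₁₂) 0 0 = Real.log 2 ∧
        states β half (coupling J₁₁ J₁₂) 0 = {0}) ∧
    -- zero field, `t < 1`
    (t < 1 →
      ∃ x : ℝ, 0 < x ∧
        (∀ y : ℝ, y = Real.tanh (β * lamM / 2 * y) ↔ y = 0 ∨ y = x ∨ y = -x) ∧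
        Tendsto (fun k : ℕ => pressure β (coupling J₁₁ J₁₂) 0 (fun _ => k)) atTop
          (𝓝 (Real.log 2 + functional β half (coupling J₁₁ J₁₂) 0 ![x, -x])) ∧
        Real.log 2 < Real.log 2 + functional β half (coupling J₁₁ J₁₂) 0 ![x, -x] ∧
        states β half (coupling J₁₁ J₁₂) 0 = {![x, -x], ![-x, x]}) ∧
    -- an infinitesimal field with different components
    (∀ ε > 0, ∃ δ > 0, ∀ h : Fin 2 → ℝ, |h 0| < δ → |h 1| < δ → h 0 ≠ h 1 →
      ∃ m : Fin 2 → ℝ, states β half (coupling J₁₁ J₁₂) h = {m} ∧ 0 < m ⬝ᵥ h ∧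
        Tendsto (fun k : ℕ => pressure β (coupling J₁₁ J₁₂) h (fun _ => k)) atTop
          (𝓝 (Real.log 2 + functional β half (coupling J₁₁ J₁₂) h m)) ∧
        ∃ s ∈ states β half (coupling J₁₁ J₁₂) 0, dist m s < ε ∧ (t < 1 → 0 < s ⬝ᵥ h)) ∧
    -- a field with equal components
    (∀ c : ℝ, ∀ μ : Fin 2 → ℝ,
      functional β half (coupling J₁₁ J₁₂) ![c, c] (swap μ) =
          functional β half (coupling J₁₁ J₁₂) ![c, c] μ ∧
        (swap μ ∈ states β half (coupling J₁₁ J₁₂) ![c, c] ↔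
          μ ∈ states β half (coupling J₁₁ J₁₂) ![c, c])) ∧
    (t < 1 → ∀ ε > 0, ∃ δ > 0, ∀ c : ℝ, |c| < δ →
      ∃ m : Fin 2 → ℝ, m ≠ swap m ∧
        states β half (coupling J₁₁ J₁₂) ![c, c] = {m, swap m} ∧
        Tendsto (fun k : ℕ => pressure β (coupling J₁₁ J₁₂) ![c, c] (fun _ => k)) atTop
          (𝓝 (Real.log 2 + functional β half (coupling J₁₁ J₁₂) ![c, c] m)) ∧
        ∃ s ∈ states β half (coupling J₁₁ J₁₂) 0, dist m s < ε ∧ dist (swap m) (swap s) < ε) := by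
  have hlam := isGreatest_eigenvalue hJ₁₂ hlamM
  subst hlam
  have hK₀ : 0 < β * (J₁₁ - J₁₂) / 2 := half_pos (mul_pos hβ (by linarith))
  have htK : t = (β * (J₁₁ - J₁₂) / 2)⁻¹ := by rw [ht, inv_div, div_eq_mul_inv]
  have hge : 1 ≤ t ↔ β * (J₁₁ - J₁₂) / 2 ≤ 1 := by rw [htK, one_le_inv₀ hK₀]
  have hlt : t < 1 ↔ 1 < β * (J₁₁ - J₁₂) / 2 := by rw [htK, inv_lt_one₀ hK₀]
  have hlim : ∀ {h m : Fin 2 → ℝ}, m ∈ states β half (coupling J₁₁ J₁₂) h →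
      Tendsto (fun k : ℕ => pressure β (coupling J₁₁ J₁₂) h (fun _ => k)) atTop
        (𝓝 (Real.log 2 + functional β half (coupling J₁₁ J₁₂) h m)) := fun hm =>
    tendsto_pressure hβ.le (by simp [coupling]) (by simpa [coupling] using hJ₁₁.le)
      (by simpa [coupling] using hJ₁₁.le) hm
  refine ⟨fun h1 => ?_, fun h1 => ?_, fun ε hε => ?_,
    fun c μ => ⟨functional_swap_const β J₁₁ J₁₂ c μ, swap_mem_states_iff⟩, fun h1 ε hε => ?_⟩
  · have hs := states_zero_of_le_one hβ hJ₁₂ hK₀ (hge.1 h1)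
    exact ⟨hlim (hs ▸ rfl), by rw [functional_zero_zero, add_zero], hs⟩
  · obtain ⟨x, r, hr, hrx, hx1, -, htanh, hpos, hmax⟩ := exists_landau_max (hlt.1 h1)
    have hs := states_zero_of_max hβ hJ₁₂ (hr.trans_lt hrx) hx1 hmax
    refine ⟨x, hr.trans_lt hrx, htanh, hlim (hs ▸ Or.inl rfl), ?_, hs⟩
    rw [functional_antidiagonal]
    linarith
  · rcases le_or_gt 1 t with h1 | h1
    · obtain ⟨δ, hδ, H⟩ := exists_dist_zero_field_state_lt hβ J₁₁ J₁₂ hε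
      refine ⟨min δ 1, lt_min hδ one_pos, fun h h0 h0' hne => ?_⟩
      obtain ⟨m, hm⟩ := states_nonempty β half (coupling J₁₁ J₁₂) h
      obtain ⟨s, hs, hd⟩ := H h (h0.trans_le (min_le_left _ _)) (h0'.trans_le (min_le_left _ _)) m hm
      exact ⟨m, Set.eq_singleton_iff_unique_mem.2 ⟨hm, fun m' hm' =>
          eq_of_mem_states_of_le_one hβ hJ₁₂ hK₀ (hge.1 h1) hm' hm⟩,
        dotProduct_pos_of_le_one hβ hJ₁₂ hK₀ (hge.1 h1) (h0.trans_le (min_le_right _ _))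
          (h0'.trans_le (min_le_right _ _)) hne hm,
        hlim hm, s, hs, hd, fun h2 => absurd h2 (not_lt.2 h1)⟩
    · obtain ⟨x, r, hr, hrx, hx1, hconc, -, -, hmax⟩ := exists_landau_max (hlt.1 h1)
      have hx0 := hr.trans_lt hrx
      have hs := states_zero_of_max hβ hJ₁₂ hx0 hx1 hmax
      obtain ⟨δ, hδ, H⟩ := exists_states_separated hβ hrx hs hε
      refine ⟨δ, hδ, fun h h0 h0' hne => ?_⟩
      obtain ⟨m, hm⟩ := states_nonempty β half (coupling J₁₁ J₁₂) h
      have huniq : states β half (coupling J₁₁ J₁₂) h = {m} := by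
        refine Set.eq_singleton_iff_unique_mem.2 ⟨hm, fun m' hm' => ?_⟩
        refine eq_of_mem_states_of_separated hβ hJ₁₂ hconc hm' hm ?_
        have a := mul_sub_nonneg_of_mem_states hβ hm
        have a' := mul_sub_nonneg_of_mem_states hβ hm'
        -- States in opposite corners would give `h 0 - h 1` both signs, hence `h 0 = h 1`.
        rcases H h h0 h0' m hm with ⟨b, c, -⟩ | ⟨b, c, -⟩ <;>
          rcases H h h0 h0' m' hm' with ⟨b', c', -⟩ | ⟨b', c', -⟩
        · exact Or.inl ⟨b', c', b, c⟩
        · exact absurd (le_antisymm (nonpos_of_mul_nonneg_left a' (by linarith))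
            (nonneg_of_mul_nonneg_left a (by linarith))) (sub_ne_zero.2 hne)
        · exact absurd (le_antisymm (nonpos_of_mul_nonneg_left a (by linarith))
            (nonneg_of_mul_nonneg_left a' (by linarith))) (sub_ne_zero.2 hne)
        · exact Or.inr ⟨b', c', b, c⟩
      obtain ⟨s, hs0, hd, hsh⟩ : ∃ s ∈ states β half (coupling J₁₁ J₁₂) 0,
          dist m s < ε ∧ 0 < s ⬝ᵥ h := by
        have a := mul_sub_nonneg_of_mem_states hβ hm
        rcases H h h0 h0' m hm with ⟨b, c, hd⟩ | ⟨b, c, hd⟩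
        · have hp : 0 < h 0 - h 1 := lt_of_le_of_ne (nonneg_of_mul_nonneg_left a (by linarith))
            (sub_ne_zero.2 hne).symm
          refine ⟨_, hs ▸ Or.inl rfl, hd, ?_⟩
          have := mul_pos hx0 hp
          simp [dotProduct, Fin.sum_univ_two]
          linarith
        · have hp : h 0 - h 1 < 0 := lt_of_le_of_ne (nonpos_of_mul_nonneg_left a (by linarith))
            (sub_ne_zero.2 hne)
          refine ⟨_, hs ▸ Or.inr rfl, hd, ?_⟩
          have := mul_neg_of_pos_of_neg hx0 hp
          simp [dotProduct, Fin.sum_univ_two]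
          linarith
      exact ⟨m, huniq, dotProduct_pos_of_zero_field_state hβ hm hs0 hsh, hlim hm, s, hs0, hd,
        fun _ => hsh⟩
  · obtain ⟨x, r, hr, hrx, hx1, hconc, -, -, hmax⟩ := exists_landau_max (hlt.1 h1)
    have hs := states_zero_of_max hβ hJ₁₂ (hr.trans_lt hrx) hx1 hmax
    obtain ⟨δ, hδ, H⟩ := exists_states_separated hβ hrx hs hε
    refine ⟨δ, hδ, fun c hc => ?_⟩
    obtain ⟨m, hm⟩ := states_nonempty β half (coupling J₁₁ J₁₂) ![c, c]
    have H' := H ![c, c] (by simpa using hc) (by simpa using hc)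
    have hm' := swap_mem_states hm
    have s0 : swap m 0 = m 1 := rfl
    have s1 : swap m 1 = m 0 := rfl
    refine ⟨m, fun he => ?_, Set.Subset.antisymm (fun m' hm'' => ?_) ?_, hlim hm, ?_⟩
    · have := congrFun he 0
      rw [s0] at this
      rcases H' m hm with ⟨b, c, -⟩ | ⟨b, c, -⟩ <;> linarith
    · rw [Set.mem_insert_iff, Set.mem_singleton_iff]
      -- `m` and `swap m` occupy opposite corners, so any state shares its corner with one of them
      -- and equals it.
      rcases H' m hm with ⟨b, c, -⟩ | ⟨b, c, -⟩ <;>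
        rcases H' m' hm'' with ⟨b', c', -⟩ | ⟨b', c', -⟩
      · exact Or.inl (eq_of_mem_states_of_separated hβ hJ₁₂ hconc hm'' hm
          (Or.inl ⟨b', c', b, c⟩))
      · exact Or.inr (eq_of_mem_states_of_separated hβ hJ₁₂ hconc hm'' hm'
          (Or.inr ⟨b', c', s0 ▸ c, s1 ▸ b⟩))
      · exact Or.inr (eq_of_mem_states_of_separated hβ hJ₁₂ hconc hm'' hm'
          (Or.inl ⟨b', c', s0 ▸ c, s1 ▸ b⟩))
      · exact Or.inl (eq_of_mem_states_of_separated hβ hJ₁₂ hconc hm'' hm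
          (Or.inr ⟨b', c', b, c⟩))
    · rintro _ (rfl | rfl)
      exacts [hm, hm']
    · rcases H' m hm with ⟨-, -, hd⟩ | ⟨-, -, hd⟩
      · exact ⟨_, hs ▸ Or.inl rfl, hd, dist_swap_lt hε hd⟩
      · exact ⟨_, hs ▸ Or.inr rfl, hd, dist_swap_lt hε hd⟩
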